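/- Let $g\in\mathbb R$. For $c>0$ with $(c-1)^2>-2g$ put $\Delta=(c-1)^2+2g=c^2-2c+2g+1$, $\phi_1=c-1-\sqrt{\Delta}$, $\phi_r=c-1+2\sqrt{\Delta}$, $$H(\phi,y)=\tfrac12y^2-\tfrac1c\Big[\tfrac{c-1}{2}\phi^2-\tfrac16\phi^3+g\phi\Big],$$ and let $\Gamma=\Gamma_c=\{(\phi,y): H(\phi,y)=H(\phi_1,0),\ \phi>\phi_1\}$, the homoclinic orbit to the saddle $(\phi_1,0)$ of the unperturbed system $\phi'=y$, $y'=\frac1c[(c-1)\phi-\frac12\phi^2+g]$; it is parametrized by $\phi(\xi)=\phi_r-(\phi_r-\phi_1)\tanh^2\!\big(\tfrac12\sqrt{\tfrac{\phi_r-\phi_1}{3c}}\,\xi\big)$, $y=\phi'$. The reduced planar system in the ME case is $$\phi'=y,\qquad y'=\tfrac1c\big[(c-1)\phi-\tfrac12\phi^2+g\big]-\tau\,\tfrac1c\Big(\tfrac{2c-1}{c}y+\tfrac{c-1}{c}\phi y\Big)+\tau^2R(\phi,y,c,\tau), \qquad(\ast)$$ and its Melnikov function is $$M_{\text{hom-ME}}(c,g)=-\frac1c\int_{-\infty}^{\infty}\Big(\tfrac{2c-1}{c}y(\xi)^2+\tfrac{c-1}{c}\phi(\xi)y(\xi)^2\Big)d\xi$$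 along the above parametrization of $\Gamma_c$. (i) For every $c>0$ with $(c-1)^2>-2g$, $$M_{\text{hom-ME}}(c,g)=-\frac{24}{5c^2}\sqrt{\tfrac1c}\,(c^2-2c+2g+1)^{5/4}M^*(c,g),\qquad M^*(c,g)=\frac{5(c-1)}{7}\sqrt{c^2-2c+2g+1}+c^2 .$$ (ii) If $g>-\frac12$, there is exactly one $c(g)>0$ with $(c(g)-1)^2>-2g$ and $M_{\text{hom-ME}}(c(g),g)=0$, and this zero is simple: $\frac{\partial M_{\text{hom-ME}}}{\partial c}(c(g),g)\neq0$. (iii) Let $g>-\frac12$, and let $R(\phi,y,c,\tau)$ be any function of class $C^1$ on $W\cap\{\tau\ge0\}$, where $W\subseteq\mathbb R^4$ is an open set containing $(\phi,y,c(g),0)$ for all $(\phi,y)$ in the closure of $\Gamma_{c(g)}$. Then there is a function $c(g,\tau)=c(g)+O(\tau)$ (as $\tau\to0^+$) such that, for all sufficiently small $\tau>0$, system $(\ast)$ with $c=c(g,\tau)$ has a homoclinic orbit near $\Gamma_{c(g)}$: for every $\varepsilon>0$ there is $\tau_0>0$ such that for all $0<\tau<\tau_0$ there is a nonconstant solution of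 $(\ast)$ with $c=c(g,\tau)$, defined for all $\xi\in\mathbb R$ and tending to one and the same equilibrium as $\xi\to\pm\infty$, whose orbit lies in the $\varepsilon$-neighbourhood of $\Gamma_{c(g)}$ and whose $\varepsilon$-neighbourhood contains $\Gamma_{c(g)}$. -/

import Mathlib

open Filter Topology Asymptotics

noncomputable section

namespace RLW

/-- The discriminant `Δ = (c - 1)² + 2 g`. -/
def disc (c g : ℝ) : ℝ := (c - 1) ^ 2 + 2 * g

/-- Abscissa of the saddle `(φ₁, 0)` of the unperturbed system. -/
def phi1 (c g : ℝ) : ℝ := c - 1 - √(disc c g)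

/-- Abscissa of the right intersection of the homoclinic loop with the `φ`-axis. -/
def phiR (c g : ℝ) : ℝ := c - 1 + 2 * √(disc c g)

/-- The first integral `H(φ, y)` of the unperturbed system
`φ' = y`, `y' = (1 / c) * ((c - 1) φ - φ² / 2 + g)`. -/
def energy (c g : ℝ) (p : ℝ × ℝ) : ℝ :=
  p.2 ^ 2 / 2 - (1 / c) * ((c - 1) / 2 * p.1 ^ 2 - p.1 ^ 3 / 6 + g * p.1)

/-- The unperturbed homoclinic orbit `Γ`: the loop part `φ > φ₁` of the level curve of `H`
through the saddle `(φ₁, 0)`. The saddle itself does not belong to the orbit. -/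
def homoclinicLoop (c g : ℝ) : Set (ℝ × ℝ) :=
  {p | energy c g p = energy c g (phi1 c g, 0) ∧ phi1 c g < p.1}

/-- The decay rate `k = (1 / 2) √((φ_r - φ₁) / (3 c))`. -/
def waveRate (c g : ℝ) : ℝ := 1 / 2 * √((phiR c g - phi1 c g) / (3 * c))

/-- The `φ`-component of the parametrization of `Γ` by the time `ξ`; the `y`-component is its
derivative. -/
def wave (c g : ℝ) (ξ : ℝ) : ℝ :=
  phiR c g - (phiR c g - phi1 c g) * Real.tanh (waveRate c g * ξ) ^ 2

/-- The right-hand side of the reduced planar system, `R` being the coefficient of the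
`O(τ²)` remainder, as a function of `(φ, y, c, τ)`. -/
def reducedField (g : ℝ) (R : ℝ × ℝ × ℝ × ℝ → ℝ) (c τ : ℝ) (p : ℝ × ℝ) : ℝ × ℝ :=
  (p.2,
    (1 / c) * ((c - 1) * p.1 - 1 / 2 * p.1 ^ 2 + g)
      - τ * (1 / c) * ((2 * c - 1) / c * p.2 + (c - 1) / c * p.1 * p.2)
      + τ ^ 2 * R (p.1, p.2, c, τ))

/-- `γ` is a homoclinic solution of the autonomous system `γ' = X(γ)`: a solution on the whole
line, not the equilibrium itself, which tends to one and the same equilibrium at `±∞`. -/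
def IsHomoclinic (X : ℝ × ℝ → ℝ × ℝ) (γ : ℝ → ℝ × ℝ) : Prop :=
  (∀ ξ, HasDerivAt γ (X (γ ξ)) ξ) ∧
    ∃ p, X p = 0 ∧ (∃ ξ, γ ξ ≠ p) ∧ Tendsto γ atTop (𝓝 p) ∧ Tendsto γ atBot (𝓝 p)

/-- Two subsets of the plane are `ε`-near: each lies in the `ε`-neighbourhood of the other. -/
def Near (ε : ℝ) (A B : Set (ℝ × ℝ)) : Prop :=
  A ⊆ Metric.thickening ε B ∧ B ⊆ Metric.thickening ε A

/-- The Melnikov function: the integral over `Γ`, in the time `ξ`, of `y` times the coefficient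
`-(1 / c) * ((2 c - 1) / c * y + (c - 1) / c * φ * y)` of `τ` in the second equation. Equivalently,
`(1 / c) ∮ ((2 c - 1) / c * y + (c - 1) / c * φ * y) dφ` with `Γ` traversed against the flow
(counterclockwise). -/
def melnikov (c g : ℝ) : ℝ :=
  -(1 / c) * ∫ ξ : ℝ, ((2 * c - 1) / c * deriv (wave c g) ξ ^ 2
    + (c - 1) / c * wave c g ξ * deriv (wave c g) ξ ^ 2)

/-- The reduced Melnikov function `M*`. -/
def melnikovStar (c g : ℝ) : ℝ :=
  5 * (c - 1) / 7 * √(c ^ 2 - 2 * c + 2 * g + 1) + c ^ 2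

/- Consistency of the definitions: the parametrization `(wave, wave')` runs exactly through the
loop `Γ` and solves the reduced system for `τ = 0`. -/

section consistency
variable {c g : ℝ}

theorem hasDerivAt_tanh (x : ℝ) : HasDerivAt Real.tanh (1 - Real.tanh x ^ 2) x := by
  have h := (Real.hasDerivAt_sinh x).div (Real.hasDerivAt_cosh x) (Real.cosh_pos x).ne'
  have e : (Real.sinh / Real.cosh) = Real.tanh := by
    funext y; simp [Real.tanh_eq_sinh_div_cosh]
  rw [e] at h
  have h2 : 1 - Real.tanh x ^ 2 =
      (Real.cosh x * Real.cosh x - Real.sinh x * Real.sinh x) / Real.cosh x ^ 2 := by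
    rw [Real.tanh_eq_sinh_div_cosh]
    have := (Real.cosh_pos x).ne'
    field_simp
  rw [h2]
  exact h

theorem deriv_wave (c g ξ : ℝ) : deriv (wave c g) ξ =
    -(phiR c g - phi1 c g) * (2 * Real.tanh (waveRate c g * ξ)
      * ((1 - Real.tanh (waveRate c g * ξ) ^ 2) * waveRate c g)) := by
  have h1 : HasDerivAt (fun ξ => waveRate c g * ξ) (waveRate c g) ξ := by
    simpa using (hasDerivAt_id ξ).const_mul (waveRate c g)
  have h2 := ((((hasDerivAt_tanh (waveRate c g * ξ)).comp ξ h1).pow 2).const_mul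
    (phiR c g - phi1 c g)).const_sub (phiR c g)
  have h3 := h2.deriv
  simp only [Function.comp_def] at h3
  refine (Eq.trans ?_ h3).trans ?_
  · rfl
  · simp; ring

theorem homoclinicLoop_eq_range (hc : 0 < c) (hg : -2 * g < (c - 1) ^ 2) :
    homoclinicLoop c g = Set.range fun ξ => (wave c g ξ, deriv (wave c g) ξ) := by
  have hD : 0 < disc c g := by unfold disc; linarith
  obtain ⟨s, hs⟩ : ∃ s, s = √(disc c g) := ⟨_, rfl⟩
  have s0 : 0 < s := hs ▸ Real.sqrt_pos.2 hD
  have s2 : s ^ 2 = (c - 1) ^ 2 + 2 * g := by rw [hs, Real.sq_sqrt hD.le, disc]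
  have hg' : g = (s ^ 2 - (c - 1) ^ 2) / 2 := by linarith
  have e1 : phi1 c g = c - 1 - s := by rw [phi1, hs]
  have eR : phiR c g = c - 1 + 2 * s := by rw [phiR, hs]
  have hk : waveRate c g ^ 2 = s / (4 * c) := by
    have h0 : 0 ≤ (phiR c g - phi1 c g) / (3 * c) := by
      rw [e1, eR]; apply div_nonneg <;> linarith
    rw [waveRate, mul_pow, Real.sq_sqrt h0, e1, eR]; field_simp; ring
  have hk0 : 0 < waveRate c g := by
    unfold waveRate
    have : 0 < (phiR c g - phi1 c g) / (3 * c) := by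
      rw [e1, eR]; apply div_pos <;> linarith
    positivity
  have key : ∀ p : ℝ × ℝ, energy c g p = energy c g (phi1 c g, 0) ↔
      3 * c * p.2 ^ 2 = (c - 1 + 2 * s - p.1) * (p.1 - (c - 1 - s)) ^ 2 := by
    intro p
    have : energy c g p - energy c g (phi1 c g, 0) =
        (3 * c * p.2 ^ 2 - (c - 1 + 2 * s - p.1) * (p.1 - (c - 1 - s)) ^ 2) / (6 * c) := by
      simp only [energy, e1]; rw [hg']; field_simp; ring
    rw [← sub_eq_zero, this, div_eq_zero_iff, sub_eq_zero]
    have : 6 * c ≠ 0 := by positivity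
    tauto
  ext ⟨x, y⟩
  simp only [homoclinicLoop, Set.mem_ofPred_eq, key, Set.mem_range, Prod.mk.injEq]
  simp only [e1]
  constructor
  · rintro ⟨h, hx⟩
    have hle : x ≤ c - 1 + 2 * s := by
      by_contra! hlt
      have : (c - 1 + 2 * s - x) * (x - (c - 1 - s)) ^ 2 < 0 :=
        mul_neg_of_neg_of_pos (by linarith) (by apply pow_pos; linarith)
      have : 0 ≤ 3 * c * y ^ 2 := by positivity
      linarith
    obtain ⟨t, ht⟩ : ∃ t, t = y / (-(3 * s) * (2 * ((x - (c - 1 - s)) / (3 * s) * waveRate c g))) :=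
      ⟨_, rfl⟩
    have hu : 0 < x - (c - 1 - s) := by linarith
    have hy : y = -(2 * t * (x - (c - 1 - s)) * waveRate c g) := by
      rw [ht]; field_simp
    have ht2 : 3 * s * t ^ 2 = c - 1 + 2 * s - x := by
      rw [hy] at h
      have : 3 * c * (4 * t ^ 2 * (waveRate c g) ^ 2) * (x - (c - 1 - s)) ^ 2 =
          (c - 1 + 2 * s - x) * (x - (c - 1 - s)) ^ 2 := by rw [← h]; ring
      have := mul_right_cancel₀ (pow_pos hu 2).ne' this
      rw [hk] at this
      rw [← this]; field_simp
    have ht1 : t ^ 2 < 1 := by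
      have : 3 * s * t ^ 2 < 3 * s * 1 := by rw [ht2]; linarith
      exact lt_of_mul_lt_mul_left this (by positivity)
    have hmem : t ∈ Set.Ioo (-1 : ℝ) 1 := by
      have := abs_lt.1 ((sq_lt_one_iff_abs_lt_one t).1 ht1); exact this
    refine ⟨Real.artanh t / waveRate c g, ?_⟩
    have hT : Real.tanh (waveRate c g * (Real.artanh t / waveRate c g)) = t := by
      rw [mul_div_cancel₀ _ hk0.ne', Real.tanh_artanh hmem]
    rw [deriv_wave, wave, hT, e1, eR]
    constructor
    · linarith
    · rw [hy]
      have : x - (c - 1 - s) = 3 * s * (1 - t ^ 2) := by linarith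
      rw [this]; ring
  · rintro ⟨ξ, hx, hy⟩
    rw [deriv_wave, e1, eR] at hy
    rw [wave, e1, eR] at hx
    obtain ⟨t, ht⟩ : ∃ t, t = Real.tanh (waveRate c g * ξ) := ⟨_, rfl⟩
    rw [← ht] at hx hy
    have ht1 : t ^ 2 < 1 := by
      rw [sq_lt_one_iff_abs_lt_one, abs_lt, ht]
      exact Real.tanh_bijOn.1 (Set.mem_univ _)
    subst hx hy
    constructor
    · have : 3 * c * (-(c - 1 + 2 * s - (c - 1 - s)) * (2 * t * ((1 - t ^ 2) * waveRate c g))) ^ 2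
        = 3 * c * (36 * s ^ 2 * t ^ 2 * (1 - t ^ 2) ^ 2) * waveRate c g ^ 2 := by ring
      rw [this, hk]; field_simp; ring
    · nlinarith

theorem hasDerivAt_wave_unperturbed (hc : 0 < c) (hg : -2 * g < (c - 1) ^ 2)
    (R : ℝ × ℝ × ℝ × ℝ → ℝ) :
    ∀ ξ, HasDerivAt (fun ξ => (wave c g ξ, deriv (wave c g) ξ))
      (reducedField g R c 0 (wave c g ξ, deriv (wave c g) ξ)) ξ := by
  intro ξ
  have hD : 0 < disc c g := by unfold disc; linarith
  obtain ⟨s, hs⟩ : ∃ s, s = √(disc c g) := ⟨_, rfl⟩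
  have s0 : 0 < s := hs ▸ Real.sqrt_pos.2 hD
  have s2 : s ^ 2 = (c - 1) ^ 2 + 2 * g := by rw [hs, Real.sq_sqrt hD.le, disc]
  have hg' : g = (s ^ 2 - (c - 1) ^ 2) / 2 := by linarith
  have e1 : phi1 c g = c - 1 - s := by rw [phi1, hs]
  have eR : phiR c g = c - 1 + 2 * s := by rw [phiR, hs]
  have hk : waveRate c g ^ 2 = s / (4 * c) := by
    have h0 : 0 ≤ (phiR c g - phi1 c g) / (3 * c) := by
      rw [e1, eR]; apply div_nonneg <;> linarith
    rw [waveRate, mul_pow, Real.sq_sqrt h0, e1, eR]; field_simp; ring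
  have h1 : HasDerivAt (fun ξ => waveRate c g * ξ) (waveRate c g) ξ := by
    simpa using (hasDerivAt_id ξ).const_mul (waveRate c g)
  have hT := (hasDerivAt_tanh (waveRate c g * ξ)).comp ξ h1
  have hw : HasDerivAt (wave c g) (deriv (wave c g) ξ) ξ := by
    have h2 := ((hT.pow 2).const_mul (phiR c g - phi1 c g)).const_sub (phiR c g)
    exact (show DifferentiableAt ℝ (wave c g) ξ from h2.differentiableAt).hasDerivAt
  have hd : deriv (wave c g) = fun ξ => _ := funext (deriv_wave c g)
  refine hw.prodMk ?_
  have h4 := ((hT.const_mul 2).mul (((hT.pow 2).const_sub 1).mul_const (waveRate c g))).const_mul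
    (-(phiR c g - phi1 c g))
  have : HasDerivAt (deriv (wave c g)) _ ξ := hd ▸ h4
  refine this.congr_deriv ?_
  symm
  simp only [wave, e1, eR, Function.comp_apply, Pi.pow_apply]
  set t := Real.tanh (waveRate c g * ξ)
  have : waveRate c g * waveRate c g = s / (4*c) := by rw [← hk]; ring
  simp
  trans -(3*s)*(waveRate c g * waveRate c g) * (2*(1-t^2)*(1-t^2) - 4*t^2*(1-t^2))
  · rw [this]
    nth_rewrite 1 [hg']; field_simp; ring
  · ring
end consistency

end RLW

end

/-!
The Melnikov integral over `Γ` is elementary: in the variable `t = tanh (k ξ)` its integrand is a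
polynomial, so the integral reduces to `integral_tanh_sq_profile`. This gives the closed formula for
the Melnikov function; its only zero is the zero of `M*`, which is unique and simple because, for
`c < 1`, the two terms of `M*` are monotone against each other
(`exists_melnikovStar_eq_zero`, `deriv_melnikov_ne_zero`).

The persistence of the homoclinic orbit is proved by a Lyapunov–Schmidt reduction on the whole line,
without invariant manifolds. An affine change of variables (`rescale`) and the time `k ξ` carry the
reduced system to the normal form `u'' = 4 u - 6 u² + P(u, u')`, whose unperturbed homoclinic
solution `sech²` does not depend on the parameters. The linearisation `v'' = (4 - 12 sech²) v` has
an explicit fundamental system `kerSol`, `growSol`; variation of constants yields a Green operator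
`green` which is bounded on bounded continuous functions, up to the one-dimensional obstruction
`pairing h = ∫ kerSol * h`. With it the equation for the deviation `z` from `sech²` becomes a fixed
point equation `green (remainder P z) = z`, solved by the contraction principle
(`exists_green_remainder_eq`) in the closed space of functions having one common limit at `±∞`.
That limit is automatically an equilibrium, so the solution is homoclinic as soon as the obstruction
`pairing (remainder P z)` vanishes.

The obstruction equals `τ` times a positive multiple of `M*(c, g)`, up to `O(τ²)`, and it depends
continuously on `c`. As `M*` has a simple zero at `c₀`, the obstruction changes sign on
`[c₀ - K τ, c₀ + K τ]`, and the intermediate value theorem provides `c(τ)`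
(`exists_homoclinic_branch`). Only a Lipschitz bound on the `O(τ²)` term enters, so `R`, which is
given near `Γ` and for `τ ≥ 0` only, may be replaced by a globally Lipschitz extension
(`exists_lipschitzWith_eqOn`).
-/

noncomputable section

namespace RLW

open Real MeasureTheory
open scoped BoundedContinuousFunction NNReal

/-! ### The Melnikov integral -/

theorem tendsto_tanh_atTop : Tendsto tanh atTop (𝓝 1) := by
  have h : tanh = fun x : ℝ => 1 - 2 / (exp (2 * x) + 1) := by
    funext x
    rw [tanh_eq_sinh_div_cosh, sinh_eq, cosh_eq, exp_neg, two_mul, exp_add]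
    have := exp_pos x
    field_simp
    ring
  rw [h]
  have h1 : Tendsto (fun x : ℝ => exp (2 * x) + 1) atTop atTop :=
    tendsto_atTop_add_const_right _ _
      (tendsto_exp_atTop.comp (tendsto_id.const_mul_atTop two_pos))
  simpa using (h1.const_div_atTop 2).const_sub 1

theorem tendsto_tanh_atBot : Tendsto tanh atBot (𝓝 (-1)) := by
  have h := (tendsto_tanh_atTop.comp tendsto_neg_atBot_atTop).neg
  refine h.congr fun x => ?_
  simp [tanh_neg]

theorem continuous_tanh : Continuous tanh :=
  continuous_iff_continuousAt.2 fun x => (hasDerivAt_tanh x).continuousAt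

theorem one_sub_tanh_sq (x : ℝ) : 1 - tanh x ^ 2 = (cosh x ^ 2)⁻¹ := by
  have h := (cosh_pos x).ne'
  rw [tanh_eq_sinh_div_cosh]
  field_simp
  linarith [cosh_sq x]

theorem integrable_one_sub_tanh_sq : Integrable fun x => 1 - tanh x ^ 2 := by
  have hpos : ∀ x : ℝ, 0 ≤ 1 - tanh x ^ 2 := fun x => by
    have := tanh_sq_lt_one x; linarith
  have h1 : IntegrableOn (fun x => 1 - tanh x ^ 2) (Set.Ioi 0) :=
    integrableOn_Ioi_deriv_of_nonneg' (fun x _ => hasDerivAt_tanh x) (fun x _ => hpos x)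
      tendsto_tanh_atTop
  have h2 : IntegrableOn (fun x => 1 - tanh x ^ 2) (Set.Iic 0) := by
    have := IntegrableOn.comp_neg_Iio (c := (0 : ℝ)) (neg_zero (G := ℝ) ▸ h1)
    simp only [tanh_neg, neg_sq] at this
    exact (integrableOn_Iic_iff_integrableOn_Iio (by simp)).2 this
  have := h2.union h1
  rwa [Set.Iic_union_Ioi, integrableOn_univ] at this

/-- A primitive in the variable `tanh x` turns the integral over the line into one over
`(-1, 1)`. -/
theorem integral_one_sub_tanh_sq_mul {f F : ℝ → ℝ} (hF : ∀ t, HasDerivAt F (f t) t)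
    (hf : Continuous f) :
    ∫ x, (1 - tanh x ^ 2) * f (tanh x) = F 1 - F (-1) := by
  obtain ⟨C, hC⟩ := (isCompact_Icc (a := (-1 : ℝ)) (b := 1)).exists_bound_of_continuousOn
    hf.continuousOn
  have hint : Integrable fun x => (1 - tanh x ^ 2) * f (tanh x) := by
    refine integrable_one_sub_tanh_sq.mul_bdd (c := C)
      (hf.comp continuous_tanh).aestronglyMeasurable (ae_of_all _ fun x => hC _ ?_)
    exact ⟨(neg_one_lt_tanh x).le, (tanh_lt_one x).le⟩
  refine integral_of_hasDerivAt_of_tendsto (f := fun x => F (tanh x)) (fun x => ?_) hint ?_ ?_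
  · have := (hF (tanh x)).comp x (hasDerivAt_tanh x)
    rwa [mul_comm] at this
  · exact ((hF _).continuousAt.tendsto).comp tendsto_tanh_atBot
  · exact ((hF _).continuousAt.tendsto).comp tendsto_tanh_atTop

theorem integral_tanh_sq_profile (a b : ℝ) :
    ∫ x, tanh x ^ 2 * (1 - tanh x ^ 2) ^ 2 * (a + b * (1 - tanh x ^ 2))
      = 4 / 15 * (a + 4 / 7 * b) := by
  have h := integral_one_sub_tanh_sq_mul
    (f := fun t => t ^ 2 * (1 - t ^ 2) * (a + b * (1 - t ^ 2)))
    (F := fun t => a * (t ^ 3 / 3 - t ^ 5 / 5) + b * (t ^ 3 / 3 - 2 * (t ^ 5 / 5) + t ^ 7 / 7))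
    (fun t => by
      have h3 := (hasDerivAt_pow 3 t).div_const 3
      have h5 := (hasDerivAt_pow 5 t).div_const 5
      have h7 := (hasDerivAt_pow 7 t).div_const 7
      refine (((h3.sub h5).const_mul a).add
        (((h3.sub (h5.const_mul 2)).add h7).const_mul b)).congr_deriv ?_
      norm_num
      ring) (by fun_prop)
  calc _ = ∫ x, (1 - tanh x ^ 2) *
          (tanh x ^ 2 * (1 - tanh x ^ 2) * (a + b * (1 - tanh x ^ 2))) := by
        congr 1; funext x; ring
    _ = _ := h
    _ = _ := by norm_num; ring

theorem waveRate_sq {c g : ℝ} (hc : 0 < c) : waveRate c g ^ 2 = √(disc c g) / (4 * c) := by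
  have h : phiR c g - phi1 c g = 3 * √(disc c g) := by rw [phiR, phi1]; ring
  rw [waveRate, h, mul_pow, sq_sqrt (by positivity)]
  field_simp
  ring

theorem waveRate_pos {c g : ℝ} (hc : 0 < c) (hD : 0 < disc c g) : 0 < waveRate c g := by
  have h : phiR c g - phi1 c g = 3 * √(disc c g) := by rw [phiR, phi1]; ring
  have := sqrt_pos.2 hD
  rw [waveRate, h]
  positivity

theorem wave_eq (c g ξ : ℝ) :
    wave c g ξ = phi1 c g + 3 * √(disc c g) * (1 - tanh (waveRate c g * ξ) ^ 2) := by
  rw [wave, phiR, phi1]; ring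

theorem deriv_wave_eq (c g ξ : ℝ) :
    deriv (wave c g) ξ = 3 * √(disc c g) * waveRate c g *
      (-2 * (tanh (waveRate c g * ξ) * (1 - tanh (waveRate c g * ξ) ^ 2))) := by
  rw [deriv_wave, phiR, phi1]; ring

theorem melnikovStar_eq (c g : ℝ) :
    melnikovStar c g = 5 * (c - 1) / 7 * √(disc c g) + c ^ 2 := by
  rw [melnikovStar, disc]; ring_nf

theorem melnikov_eq_waveRate {c g : ℝ} (hc : 0 < c) (hD : 0 < disc c g) :
    melnikov c g = -(48 / 5) * (disc c g * waveRate c g / c ^ 2) * melnikovStar c g := by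
  have hk := waveRate_pos hc hD
  have hs2 := sq_sqrt hD.le
  set k := waveRate c g with hkdef
  set s := √(disc c g) with hs
  let f : ℝ → ℝ := fun x => tanh x ^ 2 * (1 - tanh x ^ 2) ^ 2 *
    (36 * s ^ 2 * k ^ 2 * ((2 * c - 1) / c + (c - 1) / c * phi1 c g)
      + 36 * s ^ 2 * k ^ 2 * ((c - 1) / c * (3 * s)) * (1 - tanh x ^ 2))
  have h1 : (fun ξ : ℝ => (2 * c - 1) / c * deriv (wave c g) ξ ^ 2
      + (c - 1) / c * wave c g ξ * deriv (wave c g) ξ ^ 2) = fun ξ => f (k * ξ) := by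
    funext ξ
    rw [deriv_wave_eq, wave_eq, ← hkdef, ← hs]
    ring
  rw [melnikov, h1, Measure.integral_comp_mul_left f, integral_tanh_sq_profile,
    abs_of_pos (inv_pos.2 hk), melnikovStar_eq, ← hs, phi1, ← hs, ← hs2, smul_eq_mul]
  field_simp
  ring

theorem melnikov_eq {c g : ℝ} (hc : 0 < c) (hg : -2 * g < (c - 1) ^ 2) :
    melnikov c g = -(24 / (5 * c ^ 2)) * √(1 / c)
        * (c ^ 2 - 2 * c + 2 * g + 1) ^ (5 / 4 : ℝ) * melnikovStar c g := by
  have hD : 0 < disc c g := by rw [disc]; linarith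
  have hd : c ^ 2 - 2 * c + 2 * g + 1 = disc c g := by rw [disc]; ring
  have h4 : disc c g ^ (5 / 4 : ℝ) = disc c g * √(√(disc c g)) := by
    rw [sqrt_eq_rpow, sqrt_eq_rpow, ← rpow_mul hD.le, ← rpow_one_add' hD.le (by norm_num)]
    norm_num
  have hk : waveRate c g = 1 / 2 * (√(1 / c) * √(√(disc c g))) := by
    have h : phiR c g - phi1 c g = 3 * √(disc c g) := by rw [phiR, phi1]; ring
    rw [waveRate, h, ← sqrt_mul (by positivity)]
    congr 2
    field_simp
  rw [melnikov_eq_waveRate hc hD, hd, h4, hk]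
  field_simp
  ring

/-! ### The zero of the Melnikov function -/

/-- The product rule at a zero of one factor, where the other factor only has to be continuous. -/
theorem hasDerivAt_mul_of_eq_zero {a f : ℝ → ℝ} {f' x : ℝ} (ha : ContinuousAt a x)
    (hf : HasDerivAt f f' x) (h0 : f x = 0) : HasDerivAt (fun y => a y * f y) (a x * f') x := by
  rw [hasDerivAt_iff_tendsto_slope] at hf ⊢
  refine ((ha.tendsto.mono_left nhdsWithin_le_nhds).mul hf).congr fun y => ?_
  simp only [slope_def_field, h0]
  ring

theorem hasDerivAt_melnikovStar {c g : ℝ} (hD : 0 < disc c g) :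
    HasDerivAt (fun c => melnikovStar c g)
      (5 / 7 * √(disc c g) + 5 * (c - 1) ^ 2 / 7 / √(disc c g) + 2 * c) c := by
  have h1 : HasDerivAt (fun c => disc c g) (2 * (c - 1)) c := by
    refine ((((hasDerivAt_id c).sub_const 1).pow 2).add_const (2 * g)).congr_deriv ?_
    simp
  have h2 := ((((hasDerivAt_id c).sub_const 1).const_mul 5).div_const 7).mul (h1.sqrt hD.ne')
  refine ((h2.add (hasDerivAt_pow 2 c)).congr_of_eventuallyEq
    (Eventually.of_forall fun x => melnikovStar_eq x g)).congr_deriv ?_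
  have := sqrt_pos.2 hD
  simp only [id, Nat.cast_ofNat]
  field_simp
  ring

theorem deriv_melnikovStar_pos {c g : ℝ} (hc : 0 < c) (hD : 0 < disc c g) :
    0 < 5 / 7 * √(disc c g) + 5 * (c - 1) ^ 2 / 7 / √(disc c g) + 2 * c := by
  have := sqrt_pos.2 hD
  positivity

theorem continuous_disc (g : ℝ) : Continuous fun c => disc c g := by
  unfold disc; fun_prop

theorem continuousAt_waveRate (g : ℝ) {c : ℝ} (hc : 0 < c) :
    ContinuousAt (fun c => waveRate c g) c := by
  unfold waveRate phiR phi1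
  have := (continuous_disc g).continuousAt (x := c)
  have h3 : (3 * c : ℝ) ≠ 0 := by positivity
  exact continuousAt_const.mul (ContinuousAt.sqrt (ContinuousAt.div (by fun_prop) (by fun_prop) h3))

theorem melnikov_eq_zero_iff {c g : ℝ} (hc : 0 < c) (hD : 0 < disc c g) :
    melnikov c g = 0 ↔ melnikovStar c g = 0 := by
  have := waveRate_pos hc hD
  rw [melnikov_eq_waveRate hc hD, mul_eq_zero, or_iff_right]
  have : 0 < disc c g * waveRate c g / c ^ 2 := by positivity
  linarith

/-- A zero of `M*` is a simple zero of the Melnikov function. -/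
theorem deriv_melnikov_ne_zero {c g : ℝ} (hc : 0 < c) (hD : 0 < disc c g)
    (h0 : melnikovStar c g = 0) : deriv (fun c => melnikov c g) c ≠ 0 := by
  have hcont : ContinuousAt (fun c => -(48 / 5) * (disc c g * waveRate c g / c ^ 2)) c :=
    continuousAt_const.mul (((continuous_disc g).continuousAt.mul
      (continuousAt_waveRate g hc)).div (by fun_prop) (by positivity))
  have h := hasDerivAt_mul_of_eq_zero hcont (hasDerivAt_melnikovStar hD) h0
  have he : (fun c => melnikov c g) =ᶠ[𝓝 c] fun c =>
      -(48 / 5) * (disc c g * waveRate c g / c ^ 2) * melnikovStar c g := by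
    filter_upwards [lt_mem_nhds hc, (continuous_disc g).continuousAt.eventually (lt_mem_nhds hD)]
      with x hx hx' using melnikov_eq_waveRate hx hx'
  rw [(h.congr_of_eventuallyEq he).deriv]
  have h1 := waveRate_pos hc hD
  have h2 : 0 < disc c g * waveRate c g / c ^ 2 := by positivity
  exact mul_ne_zero (by linarith) (deriv_melnikovStar_pos hc hD).ne'

/-- For `g > -1/2` the function `M*` vanishes exactly once: in `u = 1 - c` the equation reads
`(1 - u)² = (5/7) u √(u² + 2g)`, where for `0 < u < 1` the left side decreases and the right side
increases, while `M* > 0` for `c ≥ 1`. -/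
theorem exists_melnikovStar_eq_zero {g : ℝ} (hg : -1 / 2 < g) :
    ∃ c, 0 < c ∧ 0 < disc c g ∧ melnikovStar c g = 0 ∧
      ∀ c', 0 < c' → 0 < disc c' g → melnikovStar c' g = 0 → c' = c := by
  have hcont : Continuous fun c => melnikovStar c g := by unfold melnikovStar; fun_prop
  -- the left end of the admissible range of `u`
  set u₁ : ℝ := √(max 0 (-2 * g)) with hu
  have hu0 : 0 ≤ u₁ := sqrt_nonneg _
  have hu1 : u₁ < 1 := by
    rw [hu, sqrt_lt' one_pos]
    exact max_lt (by norm_num) (by linarith)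
  have hu2 : u₁ ^ 2 = max 0 (-2 * g) := sq_sqrt (le_max_left _ _)
  have hd0 : disc 0 g = 1 + 2 * g := by rw [disc]; ring
  have hneg : melnikovStar 0 g < 0 := by
    have : 0 < √(disc 0 g) := sqrt_pos.2 (by rw [hd0]; linarith)
    rw [melnikovStar_eq]
    linarith
  have hpos : 0 < melnikovStar (1 - u₁) g := by
    have h1 : u₁ * √(disc (1 - u₁) g) = 0 := by
      rcases le_total 0 g with h | h
      · have : u₁ = 0 := by rw [hu, max_eq_left (by linarith), sqrt_zero]
        rw [this, zero_mul]
      · have : disc (1 - u₁) g = 0 := by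
          rw [max_eq_right (by linarith)] at hu2
          rw [disc]; linarith
        rw [this, sqrt_zero, mul_zero]
    have h2 : 0 < (1 - u₁) ^ 2 := pow_pos (by linarith) 2
    rw [melnikovStar_eq]
    linarith
  obtain ⟨c, ⟨hc0, hc1⟩, hc⟩ := intermediate_value_Ioo (by linarith) hcont.continuousOn
    (show (0 : ℝ) ∈ Set.Ioo (melnikovStar 0 g) (melnikovStar (1 - u₁) g) from ⟨hneg, hpos⟩)
  have hD : 0 < disc c g := by
    have := le_max_right 0 (-2 * g)
    rw [disc]
    nlinarith
  refine ⟨c, hc0, hD, hc, fun c' hc' hD' h' => ?_⟩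
  have lt_one : ∀ x, 0 < x → melnikovStar x g = 0 → x < 1 := fun x hx h => by
    by_contra! h1
    have : 0 ≤ 5 * (x - 1) / 7 * √(disc x g) := mul_nonneg (by linarith) (sqrt_nonneg _)
    rw [melnikovStar_eq] at h
    nlinarith
  have key : ∀ x y, 0 < x → x < y → y < 1 → melnikovStar x g = 0 → melnikovStar y g ≠ 0 := by
    intro x y hx hxy hy h1 h2
    have hs : √(disc y g) ≤ √(disc x g) := sqrt_le_sqrt (by rw [disc, disc]; nlinarith)
    have := mul_le_mul (show 1 - y ≤ 1 - x by linarith) hs (sqrt_nonneg _) (by linarith)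
    rw [melnikovStar_eq] at h1 h2
    nlinarith
  have hlt' := lt_one c' hc' h'
  have hlt := lt_one c hc0 hc
  rcases lt_trichotomy c' c with h | h | h
  · exact absurd hc (key c' c hc' h hlt h')
  · exact h
  · exact absurd h' (key c c' hc0 h hlt' hc)

/-! ### The linearised equation at the solitary wave -/

/-- The bounded solution of `v'' = (4 - 12 sech²) v`: a multiple of the derivative of `sech²`. -/
def kerSol (x : ℝ) : ℝ := tanh x * (1 - tanh x ^ 2)

/-- The derivative of `kerSol`. -/
def kerSol' (x : ℝ) : ℝ := (1 - tanh x ^ 2) * (1 - 3 * tanh x ^ 2)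

/-- The even solution of `v'' = (4 - 12 sech²) v` whose Wronskian with `kerSol` is `1`; it grows
like `cosh²`. -/
def growSol (x : ℝ) : ℝ := 15 / 8 * (x * kerSol x + tanh x ^ 2) + cosh x ^ 2 / 4 - 5 / 4

/-- The derivative of `growSol`. -/
def growSol' (x : ℝ) : ℝ :=
  15 / 8 * (3 * kerSol x + x * kerSol' x) + cosh x ^ 2 * tanh x / 2

theorem cosh_sq_mul_one_sub (x : ℝ) : cosh x ^ 2 * (1 - tanh x ^ 2) = 1 := by
  rw [one_sub_tanh_sq, mul_inv_cancel₀ (pow_pos (cosh_pos x) 2).ne']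

theorem one_sub_tanh_sq_pos (x : ℝ) : 0 < 1 - tanh x ^ 2 := by
  have := tanh_sq_lt_one x; linarith

theorem hasDerivAt_tanh_sq (x : ℝ) :
    HasDerivAt (fun x => tanh x ^ 2) (2 * kerSol x) x := by
  refine ((hasDerivAt_tanh x).pow 2).congr_deriv ?_
  simp [kerSol]; ring

theorem hasDerivAt_cosh_sq (x : ℝ) :
    HasDerivAt (fun x => cosh x ^ 2) (2 * (cosh x ^ 2 * tanh x)) x := by
  refine ((Real.hasDerivAt_cosh x).pow 2).congr_deriv ?_
  have := (cosh_pos x).ne'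
  rw [tanh_eq_sinh_div_cosh]
  field_simp
  norm_num
  ring

theorem hasDerivAt_kerSol (x : ℝ) : HasDerivAt kerSol (kerSol' x) x := by
  refine ((hasDerivAt_tanh x).mul ((hasDerivAt_tanh_sq x).const_sub 1)).congr_deriv ?_
  simp only [kerSol, kerSol']; ring

theorem hasDerivAt_kerSol' (x : ℝ) :
    HasDerivAt kerSol' ((4 - 12 * (1 - tanh x ^ 2)) * kerSol x) x := by
  refine (((hasDerivAt_tanh_sq x).const_sub 1).mul
    (((hasDerivAt_tanh_sq x).const_mul 3).const_sub 1)).congr_deriv ?_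
  simp only [kerSol]; ring

theorem hasDerivAt_growSol (x : ℝ) : HasDerivAt growSol (growSol' x) x := by
  refine ((((((hasDerivAt_id x).mul (hasDerivAt_kerSol x)).add
    (hasDerivAt_tanh_sq x)).const_mul (15 / 8)).add
    ((hasDerivAt_cosh_sq x).div_const 4)).sub_const (5 / 4)).congr_deriv ?_
  simp only [growSol', id]; ring

theorem hasDerivAt_growSol' (x : ℝ) :
    HasDerivAt growSol' ((4 - 12 * (1 - tanh x ^ 2)) * growSol x) x := by
  refine (((((hasDerivAt_kerSol x).const_mul 3).add
    ((hasDerivAt_id x).mul (hasDerivAt_kerSol' x))).const_mul (15 / 8)).add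
    (((hasDerivAt_cosh_sq x).mul (hasDerivAt_tanh x)).div_const 2)).congr_deriv ?_
  have h := cosh_sq_mul_one_sub x
  have h' : cosh x ^ 2 * tanh x ^ 2 = cosh x ^ 2 - 1 := by linarith
  simp only [growSol, id]
  rw [kerSol']
  linear_combination (1 / 2 : ℝ) * h - 2 * h'

theorem wronskian_eq_one (x : ℝ) : kerSol x * growSol' x - kerSol' x * growSol x = 1 := by
  have h := cosh_sq_mul_one_sub x
  simp only [growSol, growSol', kerSol, kerSol']
  set t := tanh x
  linear_combination (1 / 4 * (5 * t ^ 2 - 1)) * h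

theorem one_le_cosh_sq (x : ℝ) : 1 ≤ cosh x ^ 2 := one_le_pow₀ (one_le_cosh x)

theorem abs_le_cosh_sq (x : ℝ) : |x| ≤ cosh x ^ 2 := by
  have h1 : |x| ≤ cosh x := by
    rw [← cosh_abs]
    have := self_le_sinh_iff.2 (abs_nonneg x)
    exact this.trans (sinh_lt_cosh _).le
  nlinarith [one_le_cosh x]

theorem abs_kerSol_le (x : ℝ) : |kerSol x| ≤ 1 - tanh x ^ 2 := by
  have h := one_sub_tanh_sq_pos x
  rw [kerSol, abs_mul, abs_of_pos h]
  exact mul_le_of_le_one_left h.le (abs_tanh_lt_one x).le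

theorem abs_kerSol'_le (x : ℝ) : |kerSol' x| ≤ 2 * (1 - tanh x ^ 2) := by
  have h := one_sub_tanh_sq_pos x
  rw [kerSol', abs_mul, abs_of_pos h, mul_comm]
  refine mul_le_mul_of_nonneg_right (abs_le.2 ⟨?_, ?_⟩) h.le <;> nlinarith [sq_nonneg (tanh x)]

theorem abs_mul_le_of_abs_le {x u K : ℝ} (hu : |u| ≤ K * (1 - tanh x ^ 2)) :
    |x * u| ≤ K := by
  have h := one_sub_tanh_sq_pos x
  rw [abs_mul]
  calc |x| * |u| ≤ cosh x ^ 2 * (K * (1 - tanh x ^ 2)) :=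
        mul_le_mul (abs_le_cosh_sq x) hu (abs_nonneg _) (by positivity)
    _ = K := by linear_combination K * cosh_sq_mul_one_sub x

theorem abs_growSol_le (x : ℝ) : |growSol x| ≤ 6 * cosh x ^ 2 := by
  have h1 := abs_le.1 (abs_mul_le_of_abs_le (x := x) (K := 1)
    (by rw [one_mul]; exact abs_kerSol_le x))
  have h2 := one_le_cosh_sq x
  have h3 := tanh_sq_lt_one x
  have h4 := sq_nonneg (tanh x)
  rw [growSol, abs_le]
  constructor <;> linarith

theorem abs_growSol'_le (x : ℝ) : |growSol' x| ≤ 12 * cosh x ^ 2 := by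
  have h1 := abs_le.1 (abs_mul_le_of_abs_le (x := x) (abs_kerSol'_le x))
  have h2 := one_le_cosh_sq x
  have h3 := abs_le.1 (abs_kerSol_le x)
  have h4 := sq_nonneg (tanh x)
  have h5 : |cosh x ^ 2 * tanh x| ≤ cosh x ^ 2 := by
    rw [abs_mul, abs_of_pos (by linarith)]
    exact mul_le_of_le_one_right (by linarith) (abs_tanh_lt_one x).le
  have h6 := abs_le.1 h5
  rw [growSol', abs_le]
  constructor <;> linarith

theorem continuous_kerSol : Continuous kerSol :=
  continuous_iff_continuousAt.2 fun x => (hasDerivAt_kerSol x).continuousAt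

theorem continuous_growSol : Continuous growSol :=
  continuous_iff_continuousAt.2 fun x => (hasDerivAt_growSol x).continuousAt

/-! ### A bounded Green operator -/

theorem integral_one_sub_tanh_sq : ∫ x, (1 - tanh x ^ 2) = 2 := by
  have := integral_one_sub_tanh_sq_mul (f := fun _ => 1) (F := id) hasDerivAt_id continuous_const
  simp only [mul_one, id] at this
  rw [this]; norm_num

theorem norm_kerSol_mul_le (h : ℝ →ᵇ ℝ) (x : ℝ) :
    ‖kerSol x * h x‖ ≤ ‖h‖ * (1 - tanh x ^ 2) := by
  rw [norm_mul, mul_comm]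
  exact mul_le_mul (h.norm_coe_le_norm x) (abs_kerSol_le x) (norm_nonneg _) (norm_nonneg _)

theorem integrable_kerSol_mul (h : ℝ →ᵇ ℝ) : Integrable fun x => kerSol x * h x :=
  (integrable_one_sub_tanh_sq.const_mul ‖h‖).mono'
    (continuous_kerSol.mul h.continuous).aestronglyMeasurable
    (ae_of_all _ (norm_kerSol_mul_le h))

/-- The solvability functional `h ↦ ∫ kerSol * h` of the linearised equation. -/
def pairing : (ℝ →ᵇ ℝ) →L[ℝ] ℝ :=
  LinearMap.mkContinuous
    { toFun := fun h => ∫ x, kerSol x * h x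
      map_add' := fun h h' => by
        rw [← integral_add (integrable_kerSol_mul h) (integrable_kerSol_mul h')]
        congr 1; funext x; simp [mul_add]
      map_smul' := fun a h => by
        rw [RingHom.id_apply, smul_eq_mul, ← integral_const_mul]
        congr 1; funext x; simp; ring } 2 fun h => by
    refine (norm_integral_le_of_norm_le (integrable_one_sub_tanh_sq.const_mul ‖h‖)
      (ae_of_all _ (norm_kerSol_mul_le h))).trans_eq ?_
    rw [integral_const_mul, integral_one_sub_tanh_sq, mul_comm]

theorem pairing_apply (h : ℝ →ᵇ ℝ) : pairing h = ∫ x, kerSol x * h x := rfl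

/-- `kerSol` as a bounded continuous function, normalised so that its pairing is `1`. -/
def kerDual : ℝ →ᵇ ℝ :=
  BoundedContinuousFunction.ofNormedAddCommGroup (fun x => 15 / 4 * kerSol x)
    (continuous_const.mul continuous_kerSol) 4 fun x => by
      have h1 := abs_le.1 (abs_kerSol_le x)
      have h2 := sq_nonneg (tanh x)
      rw [Real.norm_eq_abs, abs_le]
      constructor <;> linarith

theorem kerDual_apply (x : ℝ) : kerDual x = 15 / 4 * kerSol x := rfl

theorem pairing_kerDual : pairing kerDual = 1 := by
  have h := integral_tanh_sq_profile (15 / 4) 0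
  rw [pairing_apply]
  refine Eq.trans ?_ (h.trans (by norm_num))
  congr 1; funext x
  rw [kerDual_apply, kerSol]; ring

/-- The projection onto the right-hand sides for which the linearised equation has a bounded
solution. -/
def solvablePart : (ℝ →ᵇ ℝ) →L[ℝ] (ℝ →ᵇ ℝ) :=
  ContinuousLinearMap.id ℝ _ - pairing.smulRight kerDual

theorem solvablePart_apply (h : ℝ →ᵇ ℝ) (x : ℝ) :
    solvablePart h x = h x - pairing h * (15 / 4 * kerSol x) := rfl

theorem pairing_solvablePart (h : ℝ →ᵇ ℝ) : pairing (solvablePart h) = 0 := by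
  simp [solvablePart, pairing_kerDual]

/-- The coefficient of `growSol` in the variation of constants formula. -/
def growCoeff (h : ℝ →ᵇ ℝ) (ξ : ℝ) : ℝ := ∫ x in Set.Iic ξ, kerSol x * h x

/-- Minus the coefficient of `kerSol` in the variation of constants formula. -/
def kerCoeff (h : ℝ →ᵇ ℝ) (ξ : ℝ) : ℝ := ∫ x in (0 : ℝ)..ξ, growSol x * h x

theorem hasDerivAt_growCoeff (h : ℝ →ᵇ ℝ) (ξ : ℝ) :
    HasDerivAt (growCoeff h) (kerSol ξ * h ξ) ξ := by
  have hi := integrable_kerSol_mul h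
  have hc : Continuous fun x => kerSol x * h x := continuous_kerSol.mul h.continuous
  have h1 : growCoeff h = fun ξ => growCoeff h 0 + ∫ x in (0 : ℝ)..ξ, kerSol x * h x := by
    funext ξ
    rw [← intervalIntegral.integral_Iic_sub_Iic hi.integrableOn hi.integrableOn, growCoeff,
      growCoeff]
    ring
  rw [h1]
  exact (hc.integral_hasStrictDerivAt 0 ξ).hasDerivAt.const_add _

theorem hasDerivAt_kerCoeff (h : ℝ →ᵇ ℝ) (ξ : ℝ) :
    HasDerivAt (kerCoeff h) (growSol ξ * h ξ) ξ :=
  ((continuous_growSol.mul h.continuous).integral_hasStrictDerivAt 0 ξ).hasDerivAt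

theorem abs_growCoeff_le {h : ℝ →ᵇ ℝ} (h0 : pairing h = 0) (ξ : ℝ) :
    |growCoeff h ξ| ≤ ‖h‖ * (1 - tanh ξ ^ 2) := by
  have hi := integrable_kerSol_mul h
  have ht := integrable_one_sub_tanh_sq
  have h1 : |growCoeff h ξ| ≤ ‖h‖ * (1 + tanh ξ) := by
    refine (norm_integral_le_of_norm_le (ht.const_mul ‖h‖).integrableOn
      (ae_of_all _ (norm_kerSol_mul_le h))).trans_eq ?_
    rw [integral_const_mul, integral_Iic_of_hasDerivAt_of_tendsto'
      (fun x _ => hasDerivAt_tanh x) ht.integrableOn tendsto_tanh_atBot]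
    ring
  have h2 : |growCoeff h ξ| ≤ ‖h‖ * (1 - tanh ξ) := by
    have h3 : growCoeff h ξ = -∫ x in Set.Ioi ξ, kerSol x * h x := by
      rw [growCoeff, eq_neg_iff_add_eq_zero,
        intervalIntegral.integral_Iic_add_Ioi hi.integrableOn hi.integrableOn, ← pairing_apply, h0]
    rw [h3, abs_neg]
    refine (norm_integral_le_of_norm_le (ht.const_mul ‖h‖).integrableOn
      (ae_of_all _ (norm_kerSol_mul_le h))).trans_eq ?_
    rw [integral_const_mul, integral_Ioi_of_hasDerivAt_of_tendsto'
      (fun x _ => hasDerivAt_tanh x) ht.integrableOn tendsto_tanh_atTop]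
  have h4 := norm_nonneg h
  have h5 := (tanh_lt_one ξ).le
  have h6 := (neg_one_lt_tanh ξ).le
  rcases le_total 0 (tanh ξ) with h7 | h7
  · exact h2.trans (mul_le_mul_of_nonneg_left (by nlinarith) h4)
  · exact h1.trans (mul_le_mul_of_nonneg_left (by nlinarith) h4)

theorem integral_cosh_sq (ξ : ℝ) :
    ∫ x in (0 : ℝ)..ξ, cosh x ^ 2 = (ξ + sinh ξ * cosh ξ) / 2 := by
  rw [intervalIntegral.integral_eq_sub_of_hasDerivAt
    (f := fun x => (x + sinh x * cosh x) / 2) (fun x _ => ?_)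
    (Continuous.intervalIntegrable (by fun_prop) _ _)]
  · simp
  · refine (((hasDerivAt_id x).add
      ((Real.hasDerivAt_sinh x).mul (Real.hasDerivAt_cosh x))).div_const 2).congr_deriv ?_
    nlinarith [cosh_sq x]

theorem abs_kerCoeff_le (h : ℝ →ᵇ ℝ) (ξ : ℝ) : |kerCoeff h ξ| ≤ 6 * ‖h‖ * cosh ξ ^ 2 := by
  have h1 : |kerCoeff h ξ| ≤ |∫ x in (0 : ℝ)..ξ, 6 * ‖h‖ * cosh x ^ 2| := by
    have hc : Continuous fun x : ℝ => 6 * ‖h‖ * cosh x ^ 2 := by fun_prop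
    rw [kerCoeff, ← Real.norm_eq_abs]
    refine intervalIntegral.norm_integral_le_abs_of_norm_le (ae_of_all _ fun x => ?_)
      (hc.intervalIntegrable (μ := volume) _ _)
    rw [norm_mul]
    refine (mul_le_mul (abs_growSol_le x) (h.norm_coe_le_norm x) (norm_nonneg _)
      (by positivity)).trans_eq (by ring)
  refine h1.trans ?_
  rw [intervalIntegral.integral_const_mul, integral_cosh_sq, abs_mul,
    abs_of_nonneg (by positivity : 0 ≤ 6 * ‖h‖)]
  refine mul_le_mul_of_nonneg_left ?_ (by positivity)
  have h2 : |sinh ξ * cosh ξ| ≤ cosh ξ ^ 2 := by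
    rw [abs_mul, abs_of_pos (cosh_pos ξ), sq]
    refine mul_le_mul_of_nonneg_right ?_ (cosh_pos ξ).le
    exact abs_le_of_sq_le_sq (by linarith [cosh_sq ξ]) (cosh_pos ξ).le
  have h3 := abs_le.1 h2
  have h4 := abs_le.1 (abs_le_cosh_sq ξ)
  rw [abs_le]
  constructor <;> linarith

/-- The solution of `v'' = (4 - 12 sech²) v + h` given by variation of constants. -/
def greenFst (h : ℝ →ᵇ ℝ) (ξ : ℝ) : ℝ := growSol ξ * growCoeff h ξ - kerSol ξ * kerCoeff h ξ

/-- The derivative of `greenFst h`. -/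
def greenSnd (h : ℝ →ᵇ ℝ) (ξ : ℝ) : ℝ := growSol' ξ * growCoeff h ξ - kerSol' ξ * kerCoeff h ξ

theorem hasDerivAt_greenFst (h : ℝ →ᵇ ℝ) (ξ : ℝ) :
    HasDerivAt (greenFst h) (greenSnd h ξ) ξ := by
  refine (((hasDerivAt_growSol ξ).mul (hasDerivAt_growCoeff h ξ)).sub
    ((hasDerivAt_kerSol ξ).mul (hasDerivAt_kerCoeff h ξ))).congr_deriv ?_
  rw [greenSnd]; ring

theorem hasDerivAt_greenSnd (h : ℝ →ᵇ ℝ) (ξ : ℝ) :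
    HasDerivAt (greenSnd h) ((4 - 12 * (1 - tanh ξ ^ 2)) * greenFst h ξ + h ξ) ξ := by
  refine (((hasDerivAt_growSol' ξ).mul (hasDerivAt_growCoeff h ξ)).sub
    ((hasDerivAt_kerSol' ξ).mul (hasDerivAt_kerCoeff h ξ))).congr_deriv ?_
  rw [greenFst]
  linear_combination h ξ * wronskian_eq_one ξ

/-- The growth of one factor in each product of the variation of constants formula is compensated by
the decay of the other. -/
theorem abs_variation_le {a b h : ℝ} {ξ K L A B M : ℝ} (ha : |a| ≤ K * cosh ξ ^ 2)
    (hA : |A| ≤ M * (1 - tanh ξ ^ 2)) (hb : |b| ≤ L * (1 - tanh ξ ^ 2))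
    (hB : |B| ≤ 6 * M * cosh ξ ^ 2) (hh : h = a * A - b * B) :
    |h| ≤ (K + 6 * L) * M := by
  have h1 : |a| * |A| ≤ (K * cosh ξ ^ 2) * (M * (1 - tanh ξ ^ 2)) :=
    mul_le_mul ha hA (abs_nonneg _) ((abs_nonneg _).trans ha)
  have h2 : |b| * |B| ≤ (L * (1 - tanh ξ ^ 2)) * (6 * M * cosh ξ ^ 2) :=
    mul_le_mul hb hB (abs_nonneg _) ((abs_nonneg _).trans hb)
  rw [hh]
  refine (abs_sub _ _).trans ?_
  rw [abs_mul, abs_mul]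
  linear_combination h1 + h2 + (K + 6 * L) * M * cosh_sq_mul_one_sub ξ

theorem abs_greenFst_le {h : ℝ →ᵇ ℝ} (h0 : pairing h = 0) (ξ : ℝ) :
    |greenFst h ξ| ≤ 24 * ‖h‖ := by
  have := abs_variation_le (abs_growSol_le ξ) (abs_growCoeff_le h0 ξ)
    (by rw [one_mul]; exact abs_kerSol_le ξ) (abs_kerCoeff_le h ξ) (rfl : greenFst h ξ = _)
  linarith [norm_nonneg h]

theorem abs_greenSnd_le {h : ℝ →ᵇ ℝ} (h0 : pairing h = 0) (ξ : ℝ) :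
    |greenSnd h ξ| ≤ 24 * ‖h‖ := by
  have := abs_variation_le (abs_growSol'_le ξ) (abs_growCoeff_le h0 ξ)
    (abs_kerSol'_le ξ) (abs_kerCoeff_le h ξ) (rfl : greenSnd h ξ = _)
  linarith [norm_nonneg h]

theorem growCoeff_add (h h' : ℝ →ᵇ ℝ) (ξ : ℝ) :
    growCoeff (h + h') ξ = growCoeff h ξ + growCoeff h' ξ := by
  rw [growCoeff, growCoeff, growCoeff, ← integral_add (integrable_kerSol_mul h).integrableOn
    (integrable_kerSol_mul h').integrableOn]
  congr 1; funext x; simp [mul_add]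

theorem growCoeff_smul (a : ℝ) (h : ℝ →ᵇ ℝ) (ξ : ℝ) :
    growCoeff (a • h) ξ = a * growCoeff h ξ := by
  rw [growCoeff, growCoeff, ← integral_const_mul]
  congr 1; funext x; simp; ring

theorem kerCoeff_add (h h' : ℝ →ᵇ ℝ) (ξ : ℝ) :
    kerCoeff (h + h') ξ = kerCoeff h ξ + kerCoeff h' ξ := by
  have h1 : Continuous fun x => growSol x * h x := continuous_growSol.mul h.continuous
  have h2 : Continuous fun x => growSol x * h' x := continuous_growSol.mul h'.continuous
  rw [kerCoeff, kerCoeff, kerCoeff, ← intervalIntegral.integral_add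
    (h1.intervalIntegrable _ _) (h2.intervalIntegrable _ _)]
  congr 1; funext x; simp [mul_add]

theorem kerCoeff_smul (a : ℝ) (h : ℝ →ᵇ ℝ) (ξ : ℝ) :
    kerCoeff (a • h) ξ = a * kerCoeff h ξ := by
  rw [kerCoeff, kerCoeff, ← intervalIntegral.integral_const_mul]
  congr 1; funext x; simp; ring

/-- The Green operator: `green h = (v, v')`, where `v` is the solution of
`v'' = (4 - 12 sech²) v + solvablePart h` that variation of constants provides; it is bounded. -/
def green : (ℝ →ᵇ ℝ) →L[ℝ] (ℝ →ᵇ ℝ × ℝ) :=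
  (LinearMap.mkContinuous
    { toFun := fun h => BoundedContinuousFunction.ofNormedAddCommGroup
        (fun ξ => (greenFst (solvablePart h) ξ, greenSnd (solvablePart h) ξ))
        (continuous_iff_continuousAt.2 fun ξ =>
          (hasDerivAt_greenFst _ ξ).continuousAt.prodMk (hasDerivAt_greenSnd _ ξ).continuousAt)
        (24 * ‖solvablePart h‖) fun ξ => max_le
          (abs_greenFst_le (pairing_solvablePart h) ξ) (abs_greenSnd_le (pairing_solvablePart h) ξ)
      map_add' := fun h h' => by
        ext ξ <;> simp [greenFst, greenSnd, growCoeff_add, kerCoeff_add] <;> ring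
      map_smul' := fun a h => by
        ext ξ <;> simp [greenFst, greenSnd, growCoeff_smul, kerCoeff_smul] <;> ring }
    (24 * ‖solvablePart‖) fun h => by
      have h1 : 24 * ‖solvablePart h‖ ≤ 24 * ‖solvablePart‖ * ‖h‖ := by
        rw [mul_assoc]
        exact mul_le_mul_of_nonneg_left (solvablePart.le_opNorm h) (by norm_num)
      exact (BoundedContinuousFunction.norm_le (by positivity)).2 fun ξ => le_trans (max_le
        (abs_greenFst_le (pairing_solvablePart h) ξ)
        (abs_greenSnd_le (pairing_solvablePart h) ξ)) h1)

theorem hasDerivAt_green_fst (h : ℝ →ᵇ ℝ) (ξ : ℝ) :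
    HasDerivAt (fun ξ => (green h ξ).1) (green h ξ).2 ξ :=
  hasDerivAt_greenFst (solvablePart h) ξ

theorem hasDerivAt_green_snd (h : ℝ →ᵇ ℝ) (ξ : ℝ) :
    HasDerivAt (fun ξ => (green h ξ).2)
      ((4 - 12 * (1 - tanh ξ ^ 2)) * (green h ξ).1 + solvablePart h ξ) ξ :=
  hasDerivAt_greenSnd (solvablePart h) ξ

/-! ### Limits at infinity of bounded solutions -/

theorem eventually_lt_of_hasDerivAt_stable {x f : ℝ → ℝ} {m m' : ℝ}
    (hx : ∀ ξ, HasDerivAt x (-2 * x ξ + f ξ) ξ) (hf : ∀ᶠ ξ in atTop, f ξ ≤ m) (hm : m / 2 < m') :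
    ∀ᶠ ξ in atTop, x ξ < m' := by
  obtain ⟨a, ha⟩ := eventually_atTop.1 hf
  have hd : ∀ ξ, HasDerivAt (fun ξ => (x ξ - m / 2) * exp (2 * ξ)) ((f ξ - m) * exp (2 * ξ)) ξ := by
    intro ξ
    have h1 : HasDerivAt (fun ξ => exp (2 * ξ)) (exp (2 * ξ) * 2) ξ := by
      simpa using ((hasDerivAt_id ξ).const_mul 2).exp
    refine (((hx ξ).sub_const (m / 2)).mul h1).congr_deriv ?_
    ring
  have hanti : AntitoneOn (fun ξ => (x ξ - m / 2) * exp (2 * ξ)) (Set.Ici a) := by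
    refine antitoneOn_of_deriv_nonpos (convex_Ici a)
      (fun ξ _ => (hd ξ).continuousAt.continuousWithinAt)
      (fun ξ _ => (hd ξ).differentiableAt.differentiableWithinAt) fun ξ hξ => ?_
    rw [interior_Ici] at hξ
    rw [(hd ξ).deriv]
    exact mul_nonpos_of_nonpos_of_nonneg (by linarith [ha ξ hξ.le]) (exp_pos _).le
  set C := (x a - m / 2) * exp (2 * a) with hC
  have hlim : Tendsto (fun ξ : ℝ => m / 2 + C * exp (-(2 * ξ))) atTop (𝓝 (m / 2 + C * 0)) :=
    ((tendsto_exp_neg_atTop_nhds_zero.comp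
      (tendsto_id.const_mul_atTop two_pos)).const_mul C).const_add _
  rw [mul_zero, add_zero] at hlim
  filter_upwards [eventually_ge_atTop a, hlim.eventually (gt_mem_nhds hm)] with ξ h1 h2
  have h3 : (x ξ - m / 2) * exp (2 * ξ) ≤ C := hanti Set.self_mem_Ici h1 h1
  have h4 : x ξ - m / 2 ≤ C * exp (-(2 * ξ)) := by
    rw [exp_neg, ← div_eq_mul_inv, le_div_iff₀ (exp_pos _)]
    exact h3
  linarith

theorem tendsto_of_hasDerivAt_stable {x f : ℝ → ℝ} {l : ℝ}
    (hx : ∀ ξ, HasDerivAt x (-2 * x ξ + f ξ) ξ) (hf : Tendsto f atTop (𝓝 l)) :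
    Tendsto x atTop (𝓝 (l / 2)) := by
  refine tendsto_order.2 ⟨fun m hm => ?_, fun m hm => ?_⟩
  · have hx' : ∀ ξ, HasDerivAt (-x) (-2 * (-x) ξ + (-f) ξ) ξ := fun ξ =>
      (hx ξ).neg.congr_deriv (by simp; ring)
    have h := eventually_lt_of_hasDerivAt_stable (m := -(m + l / 2)) (m' := -m) hx'
      ((hf.eventually (lt_mem_nhds (show m + l / 2 < l by linarith))).mono
        fun ξ h => neg_le_neg h.le) (by linarith)
    exact h.mono fun ξ h => neg_lt_neg_iff.1 h
  · exact eventually_lt_of_hasDerivAt_stable (m := m + l / 2) hx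
      ((hf.eventually (gt_mem_nhds (show l < m + l / 2 by linarith))).mono fun ξ h => h.le)
      (by linarith)

theorem eventually_le_of_hasDerivAt_unstable {x f : ℝ → ℝ} {m C : ℝ}
    (hx : ∀ ξ, HasDerivAt x (2 * x ξ + f ξ) ξ) (hC : ∀ ξ, |x ξ| ≤ C)
    (hf : ∀ᶠ ξ in atTop, m ≤ f ξ) : ∀ᶠ ξ in atTop, x ξ ≤ -m / 2 := by
  obtain ⟨a, ha⟩ := eventually_atTop.1 hf
  have hd : ∀ ξ, HasDerivAt (fun ξ => (x ξ + m / 2) * exp (-(2 * ξ)))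
      ((f ξ - m) * exp (-(2 * ξ))) ξ := by
    intro ξ
    have h1 : HasDerivAt (fun ξ => exp (-(2 * ξ))) (exp (-(2 * ξ)) * -2) ξ := by
      simpa using ((hasDerivAt_id ξ).const_mul 2).neg.exp
    refine (((hx ξ).add_const (m / 2)).mul h1).congr_deriv ?_
    ring
  have hmono : MonotoneOn (fun ξ => (x ξ + m / 2) * exp (-(2 * ξ))) (Set.Ici a) := by
    refine monotoneOn_of_deriv_nonneg (convex_Ici a)
      (fun ξ _ => (hd ξ).continuousAt.continuousWithinAt)
      (fun ξ _ => (hd ξ).differentiableAt.differentiableWithinAt) fun ξ hξ => ?_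
    rw [interior_Ici] at hξ
    rw [(hd ξ).deriv]
    exact mul_nonneg (by linarith [ha ξ hξ.le]) (exp_pos _).le
  have hlim : Tendsto (fun ξ => (x ξ + m / 2) * exp (-(2 * ξ))) atTop (𝓝 0) := by
    have h1 : Tendsto (fun ξ : ℝ => (C + |m / 2|) * exp (-(2 * ξ))) atTop (𝓝 0) := by
      simpa using (tendsto_exp_neg_atTop_nhds_zero.comp
        (tendsto_id.const_mul_atTop (two_pos (α := ℝ)))).const_mul (C + |m / 2|)
    refine squeeze_zero_norm (fun ξ => ?_) h1
    rw [norm_mul, Real.norm_eq_abs, Real.norm_eq_abs, abs_of_pos (exp_pos _)]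
    exact mul_le_mul_of_nonneg_right ((abs_add_le _ _).trans (by linarith [hC ξ])) (exp_pos _).le
  filter_upwards [eventually_ge_atTop a] with ξ hξ
  have h1 : (x ξ + m / 2) * exp (-(2 * ξ)) ≤ 0 := by
    refine ge_of_tendsto hlim ?_
    filter_upwards [eventually_ge_atTop ξ] with η hη using hmono hξ (le_trans hξ hη) hη
  have h2 : x ξ + m / 2 ≤ 0 := nonpos_of_mul_nonpos_left h1 (exp_pos _)
  linarith

theorem tendsto_of_hasDerivAt_unstable {x f : ℝ → ℝ} {l C : ℝ}
    (hx : ∀ ξ, HasDerivAt x (2 * x ξ + f ξ) ξ) (hC : ∀ ξ, |x ξ| ≤ C)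
    (hf : Tendsto f atTop (𝓝 l)) : Tendsto x atTop (𝓝 (-l / 2)) := by
  refine tendsto_order.2 ⟨fun m hm => ?_, fun m hm => ?_⟩
  · have hx' : ∀ ξ, HasDerivAt (-x) (2 * (-x) ξ + (-f) ξ) ξ := fun ξ =>
      (hx ξ).neg.congr_deriv (by simp; ring)
    have h := eventually_le_of_hasDerivAt_unstable (m := m - l / 2) hx'
      (fun ξ => (abs_neg (x ξ)).trans_le (hC ξ))
      ((hf.eventually (gt_mem_nhds (show l < l / 2 - m by linarith))).mono
        fun ξ h => by simp only [Pi.neg_apply]; linarith)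
    refine h.mono fun ξ h => ?_
    simp only [Pi.neg_apply] at h
    linarith
  · refine (eventually_le_of_hasDerivAt_unstable (m := l / 2 - m) hx hC
      ((hf.eventually (lt_mem_nhds (show l / 2 - m < l by linarith))).mono fun ξ h => h.le)).mono
      fun ξ h => ?_
    linarith

/-- A bounded solution of `v'' = 4 v + f` converges when `f` does. -/
theorem tendsto_of_hasDerivAt_saddle {v w f : ℝ → ℝ} {l C : ℝ}
    (hv : ∀ ξ, HasDerivAt v (w ξ) ξ) (hw : ∀ ξ, HasDerivAt w (4 * v ξ + f ξ) ξ)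
    (hvC : ∀ ξ, |v ξ| ≤ C) (hwC : ∀ ξ, |w ξ| ≤ C) (hf : Tendsto f atTop (𝓝 l)) :
    Tendsto (fun ξ => (v ξ, w ξ)) atTop (𝓝 (-l / 4, 0)) := by
  have hB := tendsto_of_hasDerivAt_stable (x := fun ξ => w ξ - 2 * v ξ) (f := f)
    (fun ξ => ((hw ξ).sub ((hv ξ).const_mul 2)).congr_deriv (by ring)) hf
  have hA := tendsto_of_hasDerivAt_unstable (x := fun ξ => w ξ + 2 * v ξ) (f := f) (C := 3 * C)
    (fun ξ => ((hw ξ).add ((hv ξ).const_mul 2)).congr_deriv (by ring))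
    (fun ξ => by
      have h1 := abs_le.1 (hvC ξ)
      have h2 := abs_le.1 (hwC ξ)
      rw [abs_le]; constructor <;> linarith) hf
  refine Tendsto.prodMk_nhds ?_ ?_
  · have h := (hA.sub hB).div_const 4
    convert h using 2 <;> ring
  · have h := (hA.add hB).div_const 2
    convert h using 2 <;> ring

theorem tendsto_one_sub_tanh_sq : Tendsto (fun x => 1 - tanh x ^ 2) (cocompact ℝ) (𝓝 0) := by
  rw [cocompact_eq_atBot_atTop, tendsto_sup]
  constructor
  · simpa using (tendsto_tanh_atBot.pow 2).const_sub 1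
  · simpa using (tendsto_tanh_atTop.pow 2).const_sub 1

theorem tendsto_kerSol : Tendsto kerSol (cocompact ℝ) (𝓝 0) :=
  squeeze_zero_norm abs_kerSol_le tendsto_one_sub_tanh_sq

/-- `green` preserves the existence of a common limit at `±∞`. -/
theorem tendsto_green {h : ℝ →ᵇ ℝ} {l : ℝ} (hl : Tendsto h (cocompact ℝ) (𝓝 l)) :
    Tendsto (green h) (cocompact ℝ) (𝓝 (-l / 4, 0)) := by
  set f : ℝ → ℝ := fun ξ => -12 * (1 - tanh ξ ^ 2) * (green h ξ).1 + solvablePart h ξ with hf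
  have hC1 : ∀ ξ, |(green h ξ).1| ≤ ‖green h‖ := fun ξ =>
    (norm_fst_le _).trans ((green h).norm_coe_le_norm ξ)
  have hC2 : ∀ ξ, |(green h ξ).2| ≤ ‖green h‖ := fun ξ =>
    (norm_snd_le _).trans ((green h).norm_coe_le_norm ξ)
  have hlim : Tendsto f (cocompact ℝ) (𝓝 l) := by
    have h1 : Tendsto (fun ξ => -12 * (1 - tanh ξ ^ 2) * (green h ξ).1) (cocompact ℝ) (𝓝 0) := by
      have h2 := (tendsto_one_sub_tanh_sq.const_mul (-12)).mul_const ‖green h‖ |>.norm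
      rw [mul_zero, zero_mul, norm_zero] at h2
      refine squeeze_zero_norm (fun ξ => ?_) h2
      rw [norm_mul, norm_mul _ ‖green h‖, norm_norm]
      exact mul_le_mul_of_nonneg_left (hC1 ξ) (norm_nonneg _)
    have h3 := hl.sub ((tendsto_kerSol.const_mul (15 / 4)).const_mul (pairing h))
    have h4 := h1.add h3
    rw [mul_zero, mul_zero, sub_zero, zero_add] at h4
    exact h4
  have hd2 : ∀ ξ, HasDerivAt (fun ξ => (green h ξ).2) (4 * (green h ξ).1 + f ξ) ξ := fun ξ =>
    (hasDerivAt_green_snd h ξ).congr_deriv (by rw [hf]; ring)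
  rw [cocompact_eq_atBot_atTop, tendsto_sup] at hlim ⊢
  constructor
  · -- reflect `ξ ↦ -ξ`, which reverses the sign of the derivative
    have h1 := tendsto_of_hasDerivAt_saddle (v := fun ξ => (green h (-ξ)).1)
      (w := fun ξ => -(green h (-ξ)).2) (f := fun ξ => f (-ξ)) (C := ‖green h‖)
      (fun ξ => ((hasDerivAt_green_fst h (-ξ)).comp ξ (hasDerivAt_neg ξ)).congr_deriv (by simp))
      (fun ξ => ((hd2 (-ξ)).comp ξ (hasDerivAt_neg ξ)).neg.congr_deriv (by simp))
      (fun ξ => hC1 _) (fun ξ => (abs_neg _).trans_le (hC2 _))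
      (hlim.1.comp tendsto_neg_atTop_atBot)
    have h2 := h1.comp tendsto_neg_atBot_atTop
    have h3 := (h2.fst_nhds).prodMk_nhds h2.snd_nhds.neg
    simpa [Function.comp_def] using h3
  · exact tendsto_of_hasDerivAt_saddle (hasDerivAt_green_fst h) hd2 hC1 hC2 hlim.2

/-! ### Homoclinic solutions of the perturbed normal form -/

/-- The vector field `x' = y`, `y' = 4 x - 6 x² + P(x, y)`. For `P = 0` it has the homoclinic
solution `(sech², (sech²)')`. -/
def normalField (P : ℝ × ℝ → ℝ) (x : ℝ × ℝ) : ℝ × ℝ := (x.2, 4 * x.1 - 6 * x.1 ^ 2 + P x)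

/-- The unperturbed homoclinic solution `(sech², (sech²)')`. -/
def profile : ℝ →ᵇ ℝ × ℝ :=
  BoundedContinuousFunction.ofNormedAddCommGroup (fun x => (1 - tanh x ^ 2, -2 * kerSol x))
    ((continuous_const.sub (continuous_tanh.pow 2)).prodMk
      (continuous_const.mul continuous_kerSol)) 2 fun x => by
      have h1 := abs_le.1 (abs_kerSol_le x)
      have h2 := one_sub_tanh_sq_pos x
      have h3 := sq_nonneg (tanh x)
      refine max_le ?_ ?_ <;> rw [Real.norm_eq_abs, abs_le] <;> constructor <;> linarith

theorem profile_apply (x : ℝ) : profile x = (1 - tanh x ^ 2, -2 * kerSol x) := rfl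

theorem norm_profile_apply_le (x : ℝ) : ‖profile x‖ ≤ 2 :=
  (profile.norm_coe_le_norm x).trans
    (BoundedContinuousFunction.norm_ofNormedAddCommGroup_le _ (by norm_num) _)

theorem tendsto_profile : Tendsto profile (cocompact ℝ) (𝓝 0) := by
  have := tendsto_one_sub_tanh_sq.prodMk_nhds (tendsto_kerSol.const_mul (-2))
  rwa [mul_zero] at this

/-- The superposition operator `f ↦ P ∘ f` on bounded continuous functions. -/
def superpose (P : C(ℝ × ℝ, ℝ)) (f : ℝ →ᵇ ℝ × ℝ) : ℝ →ᵇ ℝ where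
  toContinuousMap := P.comp f.toContinuousMap
  map_bounded' := by
    obtain ⟨C, hC⟩ := (isCompact_closedBall (0 : ℝ × ℝ) ‖f‖).exists_bound_of_continuousOn
      P.continuous.continuousOn
    refine ⟨2 * C, fun x y => ?_⟩
    have h : ∀ x, ‖P (f x)‖ ≤ C := fun x =>
      hC _ (mem_closedBall_zero_iff.2 (f.norm_coe_le_norm x))
    exact (dist_le_norm_add_norm _ _).trans
      ((add_le_add (h x) (h y)).trans_eq (two_mul C).symm)

theorem superpose_apply (P : C(ℝ × ℝ, ℝ)) (f : ℝ →ᵇ ℝ × ℝ) (x : ℝ) :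
    superpose P f x = P (f x) := rfl

/-- `P` is bounded by `ε` and `ε`-Lipschitz on the ball of radius `3`, which contains the values
of `profile + z` for `‖z‖ ≤ 1`. -/
def SmallOnBall (P : ℝ × ℝ → ℝ) (ε : ℝ) : Prop :=
  (∀ x ∈ Metric.closedBall (0 : ℝ × ℝ) 3, |P x| ≤ ε) ∧
    ∀ x ∈ Metric.closedBall (0 : ℝ × ℝ) 3, ∀ y ∈ Metric.closedBall (0 : ℝ × ℝ) 3,
      |P x - P y| ≤ ε * ‖x - y‖

/-- The part of the equation for the deviation `z` from `profile` which is not linear or comes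
from the perturbation `P`. -/
def remainder (P : C(ℝ × ℝ, ℝ)) (z : ℝ →ᵇ ℝ × ℝ) : ℝ →ᵇ ℝ :=
  superpose ⟨fun x => -6 * x.1 ^ 2, by fun_prop⟩ z + superpose P (profile + z)

theorem remainder_apply (P : C(ℝ × ℝ, ℝ)) (z : ℝ →ᵇ ℝ × ℝ) (ξ : ℝ) :
    remainder P z ξ = -6 * (z ξ).1 ^ 2 + P (profile ξ + z ξ) := rfl

theorem profile_add_mem {z : ℝ →ᵇ ℝ × ℝ} (hz : ‖z‖ ≤ 1) (ξ : ℝ) :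
    profile ξ + z ξ ∈ Metric.closedBall (0 : ℝ × ℝ) 3 := by
  rw [mem_closedBall_zero_iff]
  refine (norm_add_le _ _).trans ?_
  linarith [norm_profile_apply_le ξ, z.norm_coe_le_norm ξ]

section estimates

variable {P P' : C(ℝ × ℝ, ℝ)} {ε r η : ℝ} {z z' : ℝ →ᵇ ℝ × ℝ}

theorem norm_remainder_sub_le (hP : SmallOnBall P ε) (hε : 0 ≤ ε) (hr : r ≤ 1)
    (hz : ‖z‖ ≤ r) (hz' : ‖z'‖ ≤ r) :
    ‖remainder P z - remainder P z'‖ ≤ (12 * r + ε) * ‖z - z'‖ := by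
  have hr0 : 0 ≤ r := (norm_nonneg z).trans hz
  refine (BoundedContinuousFunction.norm_le (by positivity)).2 fun ξ => ?_
  have h1 : |P (profile ξ + z ξ) - P (profile ξ + z' ξ)| ≤ ε * ‖z - z'‖ := by
    refine (hP.2 _ (profile_add_mem (hz.trans hr) ξ) _ (profile_add_mem (hz'.trans hr) ξ)).trans ?_
    rw [add_sub_add_left_eq_sub]
    exact mul_le_mul_of_nonneg_left ((z - z').norm_coe_le_norm ξ) hε
  have h2 : |(z ξ).1 - (z' ξ).1| ≤ ‖z - z'‖ :=
    (norm_fst_le (z ξ - z' ξ)).trans ((z - z').norm_coe_le_norm ξ)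
  have h3 : |(z ξ).1 + (z' ξ).1| ≤ 2 * r := by
    refine (abs_add_le _ _).trans ?_
    have a := (norm_fst_le (z ξ)).trans ((z.norm_coe_le_norm ξ).trans hz)
    have b := (norm_fst_le (z' ξ)).trans ((z'.norm_coe_le_norm ξ).trans hz')
    rw [Real.norm_eq_abs] at a b
    linarith
  have h4 := mul_le_mul h3 h2 (abs_nonneg _) (by positivity)
  have h5 : (remainder P z - remainder P z') ξ =
      -6 * (((z ξ).1 + (z' ξ).1) * ((z ξ).1 - (z' ξ).1)) +
        (P (profile ξ + z ξ) - P (profile ξ + z' ξ)) := by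
    rw [BoundedContinuousFunction.sub_apply, remainder_apply, remainder_apply]; ring
  rw [h5, Real.norm_eq_abs]
  refine (abs_add_le _ _).trans ?_
  rw [abs_mul, abs_mul, show |(-6 : ℝ)| = 6 by norm_num]
  linarith

theorem norm_remainder_le (hP : SmallOnBall P ε) (hr : r ≤ 1) (hz : ‖z‖ ≤ r) :
    ‖remainder P z‖ ≤ 6 * r ^ 2 + ε := by
  have hε : 0 ≤ ε := (abs_nonneg _).trans (hP.1 0 (by simp))
  refine (BoundedContinuousFunction.norm_le (by positivity)).2 fun ξ => ?_
  have h1 := hP.1 _ (profile_add_mem (hz.trans hr) ξ)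
  have h2 : |(z ξ).1| ≤ r := (norm_fst_le (z ξ)).trans ((z.norm_coe_le_norm ξ).trans hz)
  have h3 := sq_le_sq' (abs_le.1 h2).1 (abs_le.1 h2).2
  rw [remainder_apply, Real.norm_eq_abs]
  refine (abs_add_le _ _).trans ?_
  rw [abs_mul, abs_sq, show |(-6 : ℝ)| = 6 by norm_num]
  linarith

theorem norm_remainder_sub_remainder_le (hη : 0 ≤ η) (hz : ‖z‖ ≤ 1)
    (h : ∀ x ∈ Metric.closedBall (0 : ℝ × ℝ) 3, |P x - P' x| ≤ η) :
    ‖remainder P z - remainder P' z‖ ≤ η := by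
  refine (BoundedContinuousFunction.norm_le hη).2 fun ξ => ?_
  rw [BoundedContinuousFunction.sub_apply, remainder_apply, remainder_apply,
    add_sub_add_left_eq_sub]
  exact h _ (profile_add_mem hz ξ)

end estimates

/-- A bound for the norm of the Green operator. -/
def greenBound : ℝ := ‖green‖ + 1

theorem one_le_greenBound : 1 ≤ greenBound := by
  have := norm_nonneg green
  rw [greenBound]; linarith

theorem norm_green_le (h : ℝ →ᵇ ℝ) : ‖green h‖ ≤ greenBound * ‖h‖ :=
  (green.le_opNorm h).trans (mul_le_mul_of_nonneg_right (by rw [greenBound]; linarith)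
    (norm_nonneg h))

theorem isClosed_setOf_exists_tendsto (F : Filter ℝ) [F.NeBot] :
    IsClosed {z : ℝ →ᵇ ℝ × ℝ | ∃ l, Tendsto z F (𝓝 l)} := by
  refine isClosed_of_closure_subset fun z hz => ?_
  refine cauchy_map_iff_exists_tendsto.1 (Metric.cauchy_iff.2 ⟨inferInstance, fun ε hε => ?_⟩)
  obtain ⟨z', ⟨l, hl⟩, hd⟩ := Metric.mem_closure_iff.1 hz (ε / 4) (by positivity)
  refine ⟨Metric.ball l (ε / 2), mem_map.2 ?_, fun x hx y hy => ?_⟩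
  · filter_upwards [hl.eventually (Metric.ball_mem_nhds l (show 0 < ε / 4 by positivity))] with ξ hξ
    have h1 := BoundedContinuousFunction.dist_coe_le_dist (f := z) (g := z') ξ
    rw [Set.mem_preimage, Metric.mem_ball]
    linarith [dist_triangle (z ξ) (z' ξ) l]
  · rw [Metric.mem_ball] at hx hy
    linarith [dist_triangle_right x y l]

theorem tendsto_remainder {P : C(ℝ × ℝ, ℝ)} {z : ℝ →ᵇ ℝ × ℝ} {l : ℝ × ℝ}
    (hz : Tendsto z (cocompact ℝ) (𝓝 l)) :
    Tendsto (remainder P z) (cocompact ℝ) (𝓝 (-6 * l.1 ^ 2 + P l)) := by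
  have h1 := tendsto_profile.add hz
  rw [zero_add] at h1
  exact ((hz.fst_nhds.pow 2).const_mul (-6)).add ((P.continuous.tendsto l).comp h1)

/-- Up to the one-dimensional obstruction measured by `pairing`, the homoclinic orbit persists:
the contraction principle gives a solution near `profile` which has a common limit at `±∞`. -/
theorem exists_green_remainder_eq {P : C(ℝ × ℝ, ℝ)} {ε : ℝ} (hP : SmallOnBall P ε)
    (hε : 50 * greenBound ^ 2 * ε ≤ 1) :
    ∃ z : ℝ →ᵇ ℝ × ℝ, ‖z‖ ≤ 2 * greenBound * ε ∧ (∃ l, Tendsto z (cocompact ℝ) (𝓝 l)) ∧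
      green (remainder P z) = z := by
  have hε0 : 0 ≤ ε := (abs_nonneg _).trans (hP.1 0 (by simp))
  have hA := one_le_greenBound
  set A := greenBound with hAdef
  set r := 2 * A * ε with hr
  have hAε : A * ε ≤ A ^ 2 * ε := mul_le_mul_of_nonneg_right (by nlinarith) hε0
  have hAε0 : 0 ≤ A * ε := by positivity
  have hr1 : r ≤ 1 := by rw [hr]; linarith
  have hAr : 12 * A * r ≤ 1 / 2 := by
    have : 12 * A * r = 24 * (A ^ 2 * ε) := by rw [hr]; ring
    linarith
  have hcontr : A * (12 * r + ε) ≤ 1 / 2 := by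
    have : A * (12 * r + ε) = 24 * (A ^ 2 * ε) + A * ε := by rw [hr]; ring
    linarith
  set s : Set (ℝ →ᵇ ℝ × ℝ) :=
    Metric.closedBall 0 r ∩ {z | ∃ l, Tendsto z (cocompact ℝ) (𝓝 l)} with hs
  have hsc : IsComplete s :=
    (Metric.isClosed_closedBall.inter (isClosed_setOf_exists_tendsto _)).isComplete
  have hmaps : Set.MapsTo (fun z => green (remainder P z)) s s := by
    rintro z ⟨hz, l, hl⟩
    rw [mem_closedBall_zero_iff] at hz
    refine ⟨?_, _, tendsto_green (tendsto_remainder hl)⟩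
    rw [mem_closedBall_zero_iff]
    refine (norm_green_le _).trans ?_
    have h1 := mul_le_mul_of_nonneg_left (norm_remainder_le hP hr1 hz) (zero_le_one.trans hA)
    have h2 : r * (12 * A * r) ≤ r * (1 / 2) :=
      mul_le_mul_of_nonneg_left hAr ((norm_nonneg z).trans hz)
    nlinarith
  have hc : ContractingWith (1 / 2) (hmaps.restrict _ s s) := by
    refine ⟨by rw [← NNReal.coe_lt_coe]; norm_num, LipschitzWith.of_dist_le_mul ?_⟩
    rintro ⟨z, hz, -⟩ ⟨z', hz', -⟩
    rw [mem_closedBall_zero_iff] at hz hz'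
    change dist (green (remainder P z)) (green (remainder P z'))
      ≤ ((1 / 2 : NNReal) : ℝ) * dist z z'
    rw [dist_eq_norm, dist_eq_norm, ← map_sub]
    have h1 := mul_le_mul_of_nonneg_left (norm_remainder_sub_le hP hε0 hr1 hz hz')
      (zero_le_one.trans hA)
    have h2 := mul_le_mul_of_nonneg_right hcontr (norm_nonneg (z - z'))
    refine (norm_green_le _).trans (h1.trans ?_)
    push_cast
    linarith
  obtain ⟨z, ⟨hz, hl⟩, hfix, -⟩ := hc.exists_fixedPoint' hsc hmaps
    (x := 0) ⟨by simp; positivity, 0, tendsto_const_nhds⟩ (edist_ne_top _ _)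
  exact ⟨z, mem_closedBall_zero_iff.1 hz, hl, hfix⟩

/-- Two solutions of the reduced equation, for perturbations `η`-close to each other, have
obstructions that differ by at most `2 ‖pairing‖ η`. -/
theorem abs_pairing_remainder_sub_le {P P' : C(ℝ × ℝ, ℝ)} {ε η : ℝ} {z z' : ℝ →ᵇ ℝ × ℝ}
    (hP : SmallOnBall P ε) (hε : 50 * greenBound ^ 2 * ε ≤ 1)
    (hz : ‖z‖ ≤ 2 * greenBound * ε) (hz' : ‖z'‖ ≤ 2 * greenBound * ε)
    (hfix : green (remainder P z) = z) (hfix' : green (remainder P' z') = z') (hη : 0 ≤ η)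
    (h : ∀ x ∈ Metric.closedBall (0 : ℝ × ℝ) 3, |P x - P' x| ≤ η) :
    |pairing (remainder P z) - pairing (remainder P' z')| ≤ 2 * ‖pairing‖ * η := by
  have hε0 : 0 ≤ ε := (abs_nonneg _).trans (hP.1 0 (by simp))
  have hA := one_le_greenBound
  set A := greenBound with hAdef
  have hAε : A * ε ≤ A ^ 2 * ε := mul_le_mul_of_nonneg_right (by nlinarith) hε0
  have hAε0 : 0 ≤ A * ε := by positivity
  have hcontr : (12 * (2 * A * ε) + ε) * A ≤ 1 / 2 := by
    have : (12 * (2 * A * ε) + ε) * A = 24 * (A ^ 2 * ε) + A * ε := by ring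
    linarith
  have h1 : ‖remainder P z - remainder P' z'‖ ≤ (12 * (2 * A * ε) + ε) * ‖z - z'‖ + η := by
    rw [← sub_add_sub_cancel _ (remainder P z')]
    exact (norm_add_le _ _).trans (add_le_add (norm_remainder_sub_le hP hε0 (by linarith) hz hz')
      (norm_remainder_sub_remainder_le hη (by linarith) h))
  have h2 : ‖z - z'‖ ≤ A * ‖remainder P z - remainder P' z'‖ := by
    have := norm_green_le (remainder P z - remainder P' z')
    rwa [map_sub, hfix, hfix'] at this
  have h3 : (12 * (2 * A * ε) + ε) * ‖z - z'‖ ≤ 1 / 2 * ‖remainder P z - remainder P' z'‖ := by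
    refine (mul_le_mul_of_nonneg_left h2 (by positivity)).trans ?_
    rw [← mul_assoc]
    exact mul_le_mul_of_nonneg_right hcontr (norm_nonneg _)
  have h4 : ‖remainder P z - remainder P' z'‖ ≤ 2 * η := by linarith
  rw [← map_sub]
  refine (pairing.le_opNorm _).trans ?_
  have := mul_le_mul_of_nonneg_left h4 (norm_nonneg pairing)
  linarith

/-- To first order in the size of the perturbation the obstruction is the Melnikov integral. -/
theorem abs_pairing_remainder_sub_melnikov_le {P : C(ℝ × ℝ, ℝ)} {ε : ℝ} {z : ℝ →ᵇ ℝ × ℝ}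
    (hP : SmallOnBall P ε) (hε : 50 * greenBound ^ 2 * ε ≤ 1)
    (hz : ‖z‖ ≤ 2 * greenBound * ε) :
    |pairing (remainder P z) - pairing (superpose P profile)|
      ≤ ‖pairing‖ * (50 * greenBound ^ 2) * ε ^ 2 := by
  have hε0 : 0 ≤ ε := (abs_nonneg _).trans (hP.1 0 (by simp))
  have hA := one_le_greenBound
  set A := greenBound with hAdef
  have hAε : A * ε ≤ A ^ 2 * ε := mul_le_mul_of_nonneg_right (by nlinarith) hε0
  have hAε0 : 0 ≤ A * ε := by positivity
  have h0 : remainder P 0 = superpose P profile := by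
    ext ξ; simp [remainder_apply, superpose_apply]
  have h1 := norm_remainder_sub_le hP hε0 (by linarith) hz
    (by rw [norm_zero]; exact (norm_nonneg z).trans hz : ‖(0 : ℝ →ᵇ ℝ × ℝ)‖ ≤ _)
  rw [sub_zero, h0] at h1
  have h2 : (12 * (2 * A * ε) + ε) * ‖z‖ ≤ (25 * A * ε) * (2 * A * ε) :=
    mul_le_mul (by nlinarith) hz (norm_nonneg z) (by positivity)
  rw [← map_sub]
  refine (pairing.le_opNorm _).trans ?_
  rw [mul_assoc]
  exact mul_le_mul_of_nonneg_left (by linarith) (norm_nonneg _)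

theorem hasDerivAt_profile_add {P : C(ℝ × ℝ, ℝ)} {z : ℝ →ᵇ ℝ × ℝ}
    (hfix : green (remainder P z) = z) (h0 : pairing (remainder P z) = 0) (ξ : ℝ) :
    HasDerivAt (fun ξ => profile ξ + z ξ) (normalField P (profile ξ + z ξ)) ξ := by
  have h1 := hasDerivAt_green_fst (remainder P z) ξ
  have h2 := hasDerivAt_green_snd (remainder P z) ξ
  rw [solvablePart_apply, h0, zero_mul, sub_zero, remainder_apply] at h2
  rw [hfix] at h1 h2
  have h3 := ((hasDerivAt_tanh_sq ξ).const_sub 1).add h1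
  have h4 := ((hasDerivAt_kerSol ξ).const_mul (-2)).add h2
  refine (h3.prodMk h4).congr_deriv ?_
  rw [normalField, profile_apply, kerSol']
  ext
  · simp
  · simp only [Prod.fst_add]; ring

/-- The common limit of a solution of the reduced equation is an equilibrium, whether or not the
obstruction vanishes: its contribution `kerSol` decays. -/
theorem normalField_eq_zero_of_tendsto {P : C(ℝ × ℝ, ℝ)} {z : ℝ →ᵇ ℝ × ℝ} {l : ℝ × ℝ}
    (hfix : green (remainder P z) = z) (hl : Tendsto z (cocompact ℝ) (𝓝 l)) :
    normalField P l = 0 := by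
  have h := tendsto_green (tendsto_remainder (P := P) hl)
  rw [hfix] at h
  have h1 := tendsto_nhds_unique hl h
  have h2 : l.1 = -(-6 * l.1 ^ 2 + P l) / 4 := congrArg Prod.fst h1
  have h3 : l.2 = 0 := congrArg Prod.snd h1
  rw [normalField, h3]
  ext
  · rfl
  · simp only [Prod.snd_zero]; linarith

/-- One-parameter families: if the Melnikov integral changes sign along the family, then some
member has a homoclinic solution near `profile`. -/
theorem exists_homoclinic_of_sign_change {P : ℝ → C(ℝ × ℝ, ℝ)} {a b ε : ℝ} (hab : a ≤ b)
    (hε : 50 * greenBound ^ 2 * ε ≤ 1) (hP : ∀ c ∈ Set.Icc a b, SmallOnBall (P c) ε)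
    (hcont : ContinuousOn (fun q : ℝ × (ℝ × ℝ) => P q.1 q.2)
      (Set.Icc a b ×ˢ Metric.closedBall 0 3))
    (ha : pairing (superpose (P a) profile) ≤ -(‖pairing‖ * (50 * greenBound ^ 2) * ε ^ 2))
    (hb : ‖pairing‖ * (50 * greenBound ^ 2) * ε ^ 2 ≤ pairing (superpose (P b) profile)) :
    ∃ c ∈ Set.Icc a b, ∃ z : ℝ →ᵇ ℝ × ℝ, ‖z‖ ≤ 2 * greenBound * ε ∧
      (∀ ξ, HasDerivAt (fun ξ => profile ξ + z ξ) (normalField (P c) (profile ξ + z ξ)) ξ) ∧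
      ∃ l, Tendsto z (cocompact ℝ) (𝓝 l) ∧ normalField (P c) l = 0 := by
  have hex : ∀ c, ∃ z : ℝ →ᵇ ℝ × ℝ, c ∈ Set.Icc a b → ‖z‖ ≤ 2 * greenBound * ε ∧
      (∃ l, Tendsto z (cocompact ℝ) (𝓝 l)) ∧ green (remainder (P c) z) = z := fun c => by
    by_cases hc : c ∈ Set.Icc a b
    · obtain ⟨z, hz⟩ := exists_green_remainder_eq (hP c hc) hε
      exact ⟨z, fun _ => hz⟩
    · exact ⟨0, fun h => absurd h hc⟩
  choose z hz using hex
  have hG : ContinuousOn (fun c => pairing (remainder (P c) (z c))) (Set.Icc a b) := by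
    have huc := (isCompact_Icc.prod
      (isCompact_closedBall (0 : ℝ × ℝ) 3)).uniformContinuousOn_of_continuous hcont
    refine Metric.continuousOn_iff.2 fun c hc η hη => ?_
    have hp : 0 < 2 * ‖pairing‖ + 1 := by positivity
    obtain ⟨δ, hδ, h⟩ := Metric.uniformContinuousOn_iff.1 huc (η / (2 * ‖pairing‖ + 1))
      (div_pos hη hp)
    refine ⟨δ, hδ, fun c' hc' hcc' => ?_⟩
    have h1 := abs_pairing_remainder_sub_le (hP c' hc') hε (hz c' hc').1 (hz c hc).1
      (hz c' hc').2.2 (hz c hc).2.2 (div_pos hη hp).le fun x hx =>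
        (h (c', x) ⟨hc', hx⟩ (c, x) ⟨hc, hx⟩ (by
          rw [Prod.dist_eq, dist_self]; exact max_lt hcc' hδ)).le
    refine h1.trans_lt ?_
    rw [mul_div_assoc', div_lt_iff₀ hp]
    linarith
  have hGa := abs_le.1 (abs_pairing_remainder_sub_melnikov_le (hP a ⟨le_rfl, hab⟩) hε
    (hz a ⟨le_rfl, hab⟩).1)
  have hGb := abs_le.1 (abs_pairing_remainder_sub_melnikov_le (hP b ⟨hab, le_rfl⟩) hε
    (hz b ⟨hab, le_rfl⟩).1)
  obtain ⟨c, hc, h0⟩ := intermediate_value_Icc hab hG (show (0 : ℝ) ∈ Set.Icc _ _ from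
    ⟨by linarith, by linarith⟩)
  obtain ⟨h1, ⟨l, hl⟩, h2⟩ := hz c hc
  exact ⟨c, hc, z c, h1, hasDerivAt_profile_add h2 h0, l, hl, normalField_eq_zero_of_tendsto h2 hl⟩

theorem superpose_add (P P' : C(ℝ × ℝ, ℝ)) (f : ℝ →ᵇ ℝ × ℝ) :
    superpose (P + P') f = superpose P f + superpose P' f := rfl

theorem superpose_smul (a : ℝ) (P : C(ℝ × ℝ, ℝ)) (f : ℝ →ᵇ ℝ × ℝ) :
    superpose (a • P) f = a • superpose P f := by
  ext ξ; simp [superpose_apply]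

theorem norm_superpose_profile_le {P : C(ℝ × ℝ, ℝ)} {ε : ℝ} (hP : SmallOnBall P ε) :
    ‖superpose P profile‖ ≤ ε := by
  have hε : 0 ≤ ε := (abs_nonneg _).trans (hP.1 0 (by simp))
  refine (BoundedContinuousFunction.norm_le hε).2 fun ξ => hP.1 _ ?_
  rw [mem_closedBall_zero_iff]
  exact (norm_profile_apply_le ξ).trans (by norm_num)

theorem SmallOnBall.smul_add_smul {P P' : C(ℝ × ℝ, ℝ)} {B τ : ℝ} (hP : SmallOnBall P B)
    (hP' : SmallOnBall P' B) (h0 : 0 ≤ τ) (h1 : τ ≤ 1) :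
    SmallOnBall (τ • P + τ ^ 2 • P' : C(ℝ × ℝ, ℝ)) (2 * B * τ) := by
  have h2 : τ ^ 2 ≤ τ := by nlinarith
  refine ⟨fun x hx => ?_, fun x hx y hy => ?_⟩
  · have a := hP.1 x hx
    have b := hP'.1 x hx
    have hB := (abs_nonneg _).trans a
    simp only [ContinuousMap.add_apply, ContinuousMap.smul_apply, smul_eq_mul]
    refine (abs_add_le _ _).trans ?_
    rw [abs_mul, abs_mul, abs_of_nonneg h0, abs_sq]
    have := mul_le_mul h2 b (abs_nonneg _) h0
    have := mul_le_mul_of_nonneg_left a h0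
    linarith
  · have a := hP.2 x hx y hy
    have b := hP'.2 x hx y hy
    simp only [ContinuousMap.add_apply, ContinuousMap.smul_apply, smul_eq_mul]
    rw [show τ * P x + τ ^ 2 * P' x - (τ * P y + τ ^ 2 * P' y)
      = τ * (P x - P y) + τ ^ 2 * (P' x - P' y) by ring]
    refine (abs_add_le _ _).trans ?_
    rw [abs_mul, abs_mul, abs_of_nonneg h0, abs_sq]
    have := mul_le_mul h2 b (abs_nonneg _) h0
    have := mul_le_mul_of_nonneg_left a h0
    linarith

/-- Melnikov's theorem for the normal form: along a simple zero of the first-order obstruction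
there is a branch `c = c₀ + O(τ)` of parameters with a homoclinic solution `O(τ)`-close to
`profile`. -/
theorem exists_homoclinic_branch {Q : ℝ → C(ℝ × ℝ, ℝ)} {S : ℝ → ℝ → C(ℝ × ℝ, ℝ)}
    {c₀ δ B m' : ℝ} (hδ : 0 < δ)
    (hQ : ∀ c ∈ Set.Icc (c₀ - δ) (c₀ + δ), SmallOnBall (Q c) B)
    (hS : ∀ c ∈ Set.Icc (c₀ - δ) (c₀ + δ), ∀ τ ∈ Set.Icc (0 : ℝ) 1, SmallOnBall (S c τ) B)
    (hQc : ContinuousOn (fun q : ℝ × (ℝ × ℝ) => Q q.1 q.2)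
      (Set.Icc (c₀ - δ) (c₀ + δ) ×ˢ Metric.closedBall 0 3))
    (hSc : ∀ τ ∈ Set.Icc (0 : ℝ) 1, ContinuousOn (fun q : ℝ × (ℝ × ℝ) => S q.1 τ q.2)
      (Set.Icc (c₀ - δ) (c₀ + δ) ×ˢ Metric.closedBall 0 3))
    (hm : HasDerivAt (fun c => pairing (superpose (Q c) profile)) m' c₀) (hm' : 0 < m')
    (hm0 : pairing (superpose (Q c₀) profile) = 0) :
    ∃ K, ∀ᶠ τ in 𝓝[>] (0 : ℝ), ∃ c, ∃ z : ℝ →ᵇ ℝ × ℝ, |c - c₀| ≤ K * τ ∧ ‖z‖ ≤ K * τ ∧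
      (∀ ξ, HasDerivAt (fun ξ => profile ξ + z ξ)
        (normalField (τ • Q c + τ ^ 2 • S c τ : C(ℝ × ℝ, ℝ)) (profile ξ + z ξ)) ξ) ∧
      ∃ l, Tendsto z (cocompact ℝ) (𝓝 l) ∧
        normalField (τ • Q c + τ ^ 2 • S c τ : C(ℝ × ℝ, ℝ)) l = 0 := by
  have hB : 0 ≤ B := (abs_nonneg _).trans
    ((hQ c₀ ⟨by linarith, by linarith⟩).1 0 (by simp))
  have hA := one_le_greenBound
  set A := greenBound with hAdef
  set p := ‖pairing‖ with hp
  have hp0 : 0 ≤ p := norm_nonneg pairing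
  -- the sign of `m(c₀ ± K₁ τ)` beats the second-order terms
  set K₁ := 2 * (p * B + p * (50 * A ^ 2) * (2 * B) ^ 2) / m' with hK₁
  have hK₁0 : 0 ≤ K₁ := by positivity
  have hK₁' : m' / 2 * K₁ = p * B + p * (50 * A ^ 2) * (2 * B) ^ 2 := by
    rw [hK₁]; field_simp
  have hlin := (hasDerivAt_iff_isLittleO.1 hm).def (half_pos hm')
  rw [hm0] at hlin
  obtain ⟨δ₁, hδ₁, hlin⟩ := Metric.eventually_nhds_iff.1 hlin
  refine ⟨K₁ + 4 * A * B, ?_⟩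
  have small : ∀ K b : ℝ, 0 < b → ∀ᶠ τ in 𝓝[>] (0 : ℝ), K * τ < b := fun K b hb => by
    have : Tendsto (fun τ : ℝ => K * τ) (𝓝[>] 0) (𝓝 (K * 0)) :=
      (Continuous.tendsto (by fun_prop) 0).mono_left nhdsWithin_le_nhds
    rw [mul_zero] at this
    exact this.eventually (gt_mem_nhds hb)
  filter_upwards [self_mem_nhdsWithin, small 1 1 one_pos, small K₁ δ hδ, small K₁ δ₁ hδ₁,
    small (50 * A ^ 2 * (2 * B)) 1 one_pos] with τ (hτ : 0 < τ) h1 h2 h3 h4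
  rw [one_mul] at h1
  have hτ1 : τ ∈ Set.Icc (0 : ℝ) 1 := ⟨hτ.le, h1.le⟩
  have hK₁τ : 0 ≤ K₁ * τ := by positivity
  have hsub : Set.Icc (c₀ - K₁ * τ) (c₀ + K₁ * τ) ⊆ Set.Icc (c₀ - δ) (c₀ + δ) :=
    Set.Icc_subset_Icc (by linarith) (by linarith)
  have hpair : ∀ c ∈ Set.Icc (c₀ - K₁ * τ) (c₀ + K₁ * τ),
      |pairing (superpose (τ • Q c + τ ^ 2 • S c τ) profile)
        - τ * pairing (superpose (Q c) profile)| ≤ p * B * τ ^ 2 := fun c hc => by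
    rw [superpose_add, superpose_smul, superpose_smul, map_add, map_smul, map_smul, smul_eq_mul,
      smul_eq_mul, add_sub_cancel_left, abs_mul, abs_sq, mul_comm]
    refine mul_le_mul_of_nonneg_right ((pairing.le_opNorm _).trans ?_) (sq_nonneg τ)
    exact mul_le_mul_of_nonneg_left (norm_superpose_profile_le (hS c (hsub hc) τ hτ1)) hp0
  have hend : p * (50 * A ^ 2) * (2 * B * τ) ^ 2 + p * B * τ ^ 2 = τ * (m' / 2 * (K₁ * τ)) := by
    rw [← mul_assoc (m' / 2), hK₁']; ring
  have key : ∀ h : ℝ, |h| = K₁ * τ →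
      |pairing (superpose (Q (c₀ + h)) profile) - h * m'| ≤ m' / 2 * (K₁ * τ) := fun h hh => by
    have := hlin (y := c₀ + h) (by rw [dist_self_add_left, Real.norm_eq_abs, hh]; exact h3)
    rwa [add_sub_cancel_left, sub_zero, smul_eq_mul, Real.norm_eq_abs, Real.norm_eq_abs,
      hh] at this
  obtain ⟨c, hc, z, hz, hode, hl⟩ := exists_homoclinic_of_sign_change
    (P := fun c => τ • Q c + τ ^ 2 • S c τ) (a := c₀ - K₁ * τ) (b := c₀ + K₁ * τ)
    (ε := 2 * B * τ) (by linarith) (by linarith)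
    (fun c hc => (hQ c (hsub hc)).smul_add_smul (hS c (hsub hc) τ hτ1) hτ.le h1.le)
    (((hQc.mono (Set.prod_mono hsub subset_rfl)).const_smul τ).add
      (((hSc τ hτ1).mono (Set.prod_mono hsub subset_rfl)).const_smul (τ ^ 2)))
    (by
      have a1 := (abs_le.1 (hpair (c₀ - K₁ * τ) ⟨le_rfl, by linarith⟩)).2
      have a2 := (abs_le.1 (key (-(K₁ * τ)) (by rw [abs_neg, abs_of_nonneg hK₁τ]))).2
      rw [← sub_eq_add_neg] at a2
      have a3 := mul_le_mul_of_nonneg_left a2 hτ.le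
      linarith)
    (by
      have a1 := (abs_le.1 (hpair (c₀ + K₁ * τ) ⟨by linarith, le_rfl⟩)).1
      have a2 := (abs_le.1 (key (K₁ * τ) (abs_of_nonneg hK₁τ))).1
      have a3 := mul_le_mul_of_nonneg_left a2 hτ.le
      linarith)
  have hAB : 0 ≤ 4 * A * B * τ := by positivity
  refine ⟨c, z, ?_, ?_, hode, hl⟩
  · rw [abs_le]; constructor <;> linarith [hc.1, hc.2]
  · refine hz.trans ?_
    linarith

/-! ### Rescaling the reduced system to the normal form -/

/-- The amplitude `3 √Δ` of the solitary wave. -/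
def amplitude (c g : ℝ) : ℝ := 3 * √(disc c g)

/-- The affine change of variables `φ = φ₁ + 3 √Δ x`, `φ' = 3 √Δ k y` which, after the change of
time `ξ ↦ k ξ`, carries the normal form to the reduced system. -/
def rescale (c g : ℝ) (x : ℝ × ℝ) : ℝ × ℝ :=
  (phi1 c g + amplitude c g * x.1, amplitude c g * waveRate c g * x.2)

/-- The constant part of the damping coefficient in the rescaled variables. -/
def dampConst (c g : ℝ) : ℝ := (2 * c - 1 + (c - 1) * phi1 c g) / (c ^ 2 * waveRate c g)

/-- The linear part of the damping coefficient in the rescaled variables. -/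
def dampLin (c g : ℝ) : ℝ := (c - 1) * amplitude c g / (c ^ 2 * waveRate c g)

/-- The damping term, that is the coefficient of `τ`, in the rescaled variables. -/
def damping (g c : ℝ) : C(ℝ × ℝ, ℝ) where
  toFun x := -(dampConst c g + dampLin c g * x.1) * x.2
  continuous_toFun := by fun_prop

/-- The coefficient of `τ²` in the rescaled variables. -/
def rescaledRemainder (g : ℝ) (R : C(ℝ × ℝ × ℝ × ℝ, ℝ)) (c τ : ℝ) : C(ℝ × ℝ, ℝ) where
  toFun x := 4 * c / (3 * disc c g) * R ((rescale c g x).1, (rescale c g x).2, c, τ)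
  continuous_toFun := by unfold rescale; fun_prop

theorem waveRate_sq_mul_amplitude {c g : ℝ} (hc : 0 < c) (hD : 0 < disc c g) :
    amplitude c g * waveRate c g * waveRate c g = 3 * disc c g / (4 * c) := by
  have h := sq_sqrt hD.le
  rw [mul_assoc, ← sq, waveRate_sq hc, amplitude]
  field_simp
  exact h

theorem reducedField_rescale {c g : ℝ} (hc : 0 < c) (hD : 0 < disc c g)
    (R : C(ℝ × ℝ × ℝ × ℝ, ℝ)) (τ : ℝ) (x : ℝ × ℝ) :
    let n := normalField (τ • damping g c + τ ^ 2 • rescaledRemainder g R c τ : C(ℝ × ℝ, ℝ)) x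
    reducedField g R c τ (rescale c g x) =
      (amplitude c g * waveRate c g * n.1, amplitude c g * waveRate c g * waveRate c g * n.2) := by
  have hk := waveRate_pos hc hD
  have hs := sqrt_pos.2 hD
  have hs2 := sq_sqrt hD.le
  have hkk := waveRate_sq_mul_amplitude hc hD
  have hg : g = (√(disc c g) ^ 2 - (c - 1) ^ 2) / 2 := by rw [hs2, disc]; ring
  refine Prod.ext rfl ?_
  simp only [reducedField, normalField, ContinuousMap.add_apply, ContinuousMap.smul_apply,
    smul_eq_mul]
  -- the three orders in `τ` are treated separately
  have h0 : 1 / c * ((c - 1) * (rescale c g x).1 - 1 / 2 * (rescale c g x).1 ^ 2 + g) =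
      amplitude c g * waveRate c g * waveRate c g * (4 * x.1 - 6 * x.1 ^ 2) := by
    rw [hkk, ← hs2]
    simp only [rescale, phi1, amplitude]
    generalize √(disc c g) = s at hg
    subst hg
    field_simp
    ring
  have h1 : 1 / c * ((2 * c - 1) / c * (rescale c g x).2
      + (c - 1) / c * (rescale c g x).1 * (rescale c g x).2) =
      -(amplitude c g * waveRate c g * waveRate c g * damping g c x) := by
    simp only [rescale, damping, ContinuousMap.coe_mk, dampConst, dampLin]
    field_simp
    ring
  have h2 : R ((rescale c g x).1, (rescale c g x).2, c, τ) =
      amplitude c g * waveRate c g * waveRate c g * rescaledRemainder g R c τ x := by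
    rw [hkk]
    simp only [rescaledRemainder, ContinuousMap.coe_mk]
    field_simp
  rw [h0, h2, mul_assoc τ, h1]
  ring

theorem rescale_profile (c g ξ : ℝ) :
    rescale c g (profile (waveRate c g * ξ)) = (wave c g ξ, deriv (wave c g) ξ) := by
  rw [wave_eq, deriv_wave_eq, rescale, profile_apply, amplitude, kerSol]

theorem homoclinicLoop_eq_range_rescale {c g : ℝ} (hc : 0 < c) (hD : 0 < disc c g) :
    homoclinicLoop c g = Set.range fun η => rescale c g (profile η) := by
  have hk := (waveRate_pos hc hD).ne'
  rw [homoclinicLoop_eq_range hc (by rw [disc] at hD; linarith)]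
  ext p
  constructor
  · rintro ⟨ξ, rfl⟩
    exact ⟨_, rescale_profile c g ξ⟩
  · rintro ⟨η, rfl⟩
    refine ⟨η / waveRate c g, ?_⟩
    have h := rescale_profile c g (η / waveRate c g)
    rw [mul_div_cancel₀ _ hk] at h
    exact h.symm

theorem hasDerivAt_rescale {c g ξ : ℝ} {u : ℝ → ℝ × ℝ} {u' : ℝ × ℝ}
    (hu : HasDerivAt u u' (waveRate c g * ξ)) :
    HasDerivAt (fun ξ => rescale c g (u (waveRate c g * ξ)))
      (amplitude c g * waveRate c g * u'.1, amplitude c g * waveRate c g * waveRate c g * u'.2)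
      ξ := by
  have h1 : HasDerivAt (fun ξ => waveRate c g * ξ) (waveRate c g) ξ := by
    simpa using (hasDerivAt_id ξ).const_mul (waveRate c g)
  have h2 : HasDerivAt (fun ξ => u (waveRate c g * ξ)) (waveRate c g • u') ξ := hu.scomp ξ h1
  have h3 := (hasFDerivAt_fst (𝕜 := ℝ) (p := u (waveRate c g * ξ))).comp_hasDerivAt ξ h2
  have h4 := (hasFDerivAt_snd (𝕜 := ℝ) (p := u (waveRate c g * ξ))).comp_hasDerivAt ξ h2
  refine ((h3.const_mul (amplitude c g)).const_add (phi1 c g)).prodMk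
    (h4.const_mul (amplitude c g * waveRate c g)) |>.congr_deriv ?_
  ext <;> simp <;> ring

/-- A solution of the normal form near `profile` gives a homoclinic solution of the reduced
system. The remainder only has to agree with `R'` along that solution. -/
theorem isHomoclinic_rescale {c g τ : ℝ} (hc : 0 < c) (hD : 0 < disc c g)
    {R : ℝ × ℝ × ℝ × ℝ → ℝ} {R' : C(ℝ × ℝ × ℝ × ℝ, ℝ)} {z : ℝ →ᵇ ℝ × ℝ} {l : ℝ × ℝ}
    (hode : ∀ ξ, HasDerivAt (fun ξ => profile ξ + z ξ)
      (normalField (τ • damping g c + τ ^ 2 • rescaledRemainder g R' c τ : C(ℝ × ℝ, ℝ))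
        (profile ξ + z ξ)) ξ)
    (hl : Tendsto z (cocompact ℝ) (𝓝 l))
    (hl0 : normalField (τ • damping g c + τ ^ 2 • rescaledRemainder g R' c τ : C(ℝ × ℝ, ℝ)) l = 0)
    (hz : ‖z‖ < 1 / 2) {F : Set (ℝ × ℝ × ℝ × ℝ)} (hF : IsClosed F) (hRR' : Set.EqOn R R' F)
    (hmem : ∀ η, ((rescale c g (profile η + z η)).1, (rescale c g (profile η + z η)).2, c, τ) ∈ F) :
    IsHomoclinic (reducedField g R c τ)
      fun ξ => rescale c g (profile (waveRate c g * ξ) + z (waveRate c g * ξ)) := by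
  have hk := waveRate_pos hc hD
  have hfield : ∀ p : ℝ × ℝ, (p.1, p.2, c, τ) ∈ F →
      reducedField g R c τ p = reducedField g R' c τ p := fun p hp => by
    rw [reducedField, reducedField, hRR' hp]
  have hcr : Continuous (rescale c g) := by unfold rescale; fun_prop
  have hsum : Tendsto (fun η => rescale c g (profile η + z η)) (cocompact ℝ)
      (𝓝 (rescale c g l)) := by
    have h := tendsto_profile.add hl
    rw [zero_add] at h
    exact (hcr.tendsto l).comp h
  have hsum' := hsum
  rw [cocompact_eq_atBot_atTop, tendsto_sup] at hsum'
  have hlF : ((rescale c g l).1, (rescale c g l).2, c, τ) ∈ F := by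
    have hcont : Continuous fun p : ℝ × ℝ => (p.1, p.2, c, τ) := by fun_prop
    exact hF.mem_of_tendsto ((hcont.tendsto _).comp hsum) (Eventually.of_forall hmem)
  refine ⟨fun ξ => ?_, rescale c g l, ?_, ⟨0, fun h => ?_⟩, ?_, ?_⟩
  · rw [hfield _ (hmem _), reducedField_rescale hc hD]
    exact hasDerivAt_rescale (u := fun η => profile η + z η) (hode _)
  · rw [hfield _ hlF, reducedField_rescale hc hD]
    simp only [hl0]
    simp
  · -- `profile` starts at `(1, 0)`, while `z` cannot bridge the distance to its own limit
    have h1 := congrArg Prod.fst h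
    have hA : 0 < amplitude c g := mul_pos three_pos (sqrt_pos.2 hD)
    simp only [rescale, mul_zero, profile_apply, tanh_zero, Prod.fst_add] at h1
    have h2 : 1 + (z 0).1 = l.1 := by
      have := mul_left_cancel₀ hA.ne' (add_left_cancel h1)
      linarith
    have h3 : ‖l‖ ≤ ‖z‖ := le_of_tendsto hl.norm (Eventually.of_forall z.norm_coe_le_norm)
    have h4 := abs_le.1 ((norm_fst_le l).trans h3)
    have h5 := abs_le.1 ((norm_fst_le (z 0)).trans (z.norm_coe_le_norm 0))
    linarith
  · exact hsum'.2.comp (tendsto_id.const_mul_atTop hk)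
  · exact hsum'.1.comp (tendsto_id.const_mul_atBot hk)

/-- The Melnikov integral of the normal form is a positive multiple of `M*`. -/
theorem pairing_damping (g c : ℝ) :
    pairing (superpose (damping g c) profile) =
      8 / 15 * (1 / (c ^ 2 * waveRate c g)) * melnikovStar c g := by
  have h := integral_tanh_sq_profile (2 * dampConst c g) (2 * dampLin c g)
  have h1 : pairing (superpose (damping g c) profile) = 4 / 15 * (2 * dampConst c g
      + 4 / 7 * (2 * dampLin c g)) := by
    rw [← h, pairing_apply]
    congr 1; funext x
    simp only [superpose_apply, damping, ContinuousMap.coe_mk, profile_apply, kerSol]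
    ring
  rw [h1, melnikovStar_eq, dampConst, dampLin, phi1, amplitude]
  ring

theorem hasDerivAt_pairing_damping {c g : ℝ} (hc : 0 < c) (hD : 0 < disc c g)
    (h0 : melnikovStar c g = 0) :
    ∃ m' > 0, HasDerivAt (fun c => pairing (superpose (damping g c) profile)) m' c := by
  have hk := waveRate_pos hc hD
  have hcont : ContinuousAt (fun c => 8 / 15 * (1 / (c ^ 2 * waveRate c g))) c :=
    continuousAt_const.mul (continuousAt_const.div ((continuousAt_id.pow 2).mul
      (continuousAt_waveRate g hc)) (by simp; exact ⟨hc.ne', hk.ne'⟩))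
  have h := hasDerivAt_mul_of_eq_zero hcont (hasDerivAt_melnikovStar hD) h0
  refine ⟨_, ?_, h.congr_of_eventuallyEq (Eventually.of_forall (pairing_damping g))⟩
  have := deriv_melnikovStar_pos hc hD
  positivity

/-! ### Uniform bounds near the critical speed -/

theorem smallOnBall_damping {c g M : ℝ} (h1 : |dampConst c g| ≤ M) (h2 : |dampLin c g| ≤ M) :
    SmallOnBall (damping g c) (12 * M) := by
  have hM := (abs_nonneg _).trans h1
  have coord : ∀ x ∈ Metric.closedBall (0 : ℝ × ℝ) 3, |x.1| ≤ 3 ∧ |x.2| ≤ 3 := fun x hx => by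
    rw [mem_closedBall_zero_iff] at hx
    exact ⟨(norm_fst_le x).trans hx, (norm_snd_le x).trans hx⟩
  have hlin : ∀ x ∈ Metric.closedBall (0 : ℝ × ℝ) 3,
      |dampConst c g + dampLin c g * x.1| ≤ 4 * M := fun x hx => by
    refine (abs_add_le _ _).trans ?_
    rw [abs_mul]
    have := mul_le_mul h2 (coord x hx).1 (abs_nonneg _) hM
    linarith
  refine ⟨fun x hx => ?_, fun x hx y hy => ?_⟩
  · simp only [damping, ContinuousMap.coe_mk]
    rw [abs_mul, abs_neg]
    have := mul_le_mul (hlin x hx) (coord x hx).2 (abs_nonneg _) (by positivity)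
    linarith
  · simp only [damping, ContinuousMap.coe_mk]
    rw [show -(dampConst c g + dampLin c g * x.1) * x.2 - -(dampConst c g + dampLin c g * y.1) * y.2
      = -((dampConst c g + dampLin c g * x.1) * (x - y).2 + dampLin c g * (x - y).1 * y.2) by
        simp only [Prod.fst_sub, Prod.snd_sub]; ring, abs_neg]
    refine (abs_add_le _ _).trans ?_
    rw [abs_mul, abs_mul, abs_mul]
    have a1 := mul_le_mul (hlin x hx) (norm_snd_le (x - y)) (norm_nonneg _) (by positivity)
    have a2 := mul_le_mul (mul_le_mul h2 (norm_fst_le (x - y)) (norm_nonneg _) hM)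
      (coord y hy).2 (abs_nonneg _) (by positivity)
    rw [Real.norm_eq_abs] at a1 a2
    have a3 : 0 ≤ M * ‖x - y‖ := by positivity
    linarith

theorem smallOnBall_rescaledRemainder {c g τ M N : ℝ} {L : ℝ≥0} {R : C(ℝ × ℝ × ℝ × ℝ, ℝ)}
    (hR : LipschitzWith L R) (h1 : |4 * c / (3 * disc c g)| ≤ M) (h2 : |amplitude c g| ≤ M)
    (h3 : |amplitude c g * waveRate c g| ≤ M)
    (hN : ∀ x ∈ Metric.closedBall (0 : ℝ × ℝ) 3,
      |R ((rescale c g x).1, (rescale c g x).2, c, τ)| ≤ N) :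
    SmallOnBall (rescaledRemainder g R c τ) (M * N + M * (L * M)) := by
  have hM := (abs_nonneg _).trans h1
  have hN0 : 0 ≤ N := (abs_nonneg _).trans (hN 0 (by simp))
  refine ⟨fun x hx => ?_, fun x hx y hy => ?_⟩
  · simp only [rescaledRemainder, ContinuousMap.coe_mk]
    rw [abs_mul]
    have := mul_le_mul h1 (hN x hx) (abs_nonneg _) hM
    have : 0 ≤ M * (L * M) := by positivity
    linarith
  · simp only [rescaledRemainder, ContinuousMap.coe_mk]
    rw [← mul_sub, abs_mul]
    have hd : dist ((rescale c g x).1, (rescale c g x).2, c, τ)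
        ((rescale c g y).1, (rescale c g y).2, c, τ) ≤ M * ‖x - y‖ := by
      have a1 := mul_le_mul h2 (norm_fst_le (x - y)) (norm_nonneg _) hM
      have a2 := mul_le_mul h3 (norm_snd_le (x - y)) (norm_nonneg _) hM
      rw [Real.norm_eq_abs, ← abs_mul] at a1 a2
      have a3 : 0 ≤ M * ‖x - y‖ := by positivity
      simp only [Prod.dist_eq, rescale, Real.dist_eq, add_sub_add_left_eq_sub, ← mul_sub, sub_self,
        abs_zero]
      exact max_le a1 (max_le a2 (max_le a3 a3))
    have b1 := (hR.dist_le_mul _ _).trans (mul_le_mul_of_nonneg_left hd L.coe_nonneg)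
    rw [Real.dist_eq] at b1
    have b2 := mul_le_mul h1 b1 (abs_nonneg _) hM
    have b3 : 0 ≤ M * N * ‖x - y‖ := by positivity
    linarith

/-- A function of class `C¹` on the part of a neighbourhood of a compact set that lies in a closed
convex set agrees near the compact set with a globally Lipschitz function. -/
theorem exists_lipschitzWith_eqOn {E : Type*} [NormedAddCommGroup E] [NormedSpace ℝ E]
    [ProperSpace E] {f : E → ℝ} {W H K : Set E} (hW : IsOpen W) (hH : Convex ℝ H)
    (hHc : IsClosed H) (hK : IsCompact K) (hKW : K ⊆ W) (hf : ContDiffOn ℝ 1 f (W ∩ H)) :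
    ∃ δ > 0, ∃ L : ℝ≥0, ∃ f' : E → ℝ, LipschitzWith L f' ∧
      Set.EqOn f f' (Metric.cthickening δ K ∩ H) := by
  obtain ⟨δ, hδ, hsub⟩ := hK.exists_cthickening_subset_open hW hKW
  have hcomp : IsCompact (Metric.cthickening δ K ∩ H) := hK.cthickening.inter_right hHc
  have hloc : LocallyLipschitzOn (Metric.cthickening δ K ∩ H) f := by
    intro x hx
    obtain ⟨r, hr, hball⟩ := Metric.isOpen_iff.1 hW x (hsub hx.1)
    obtain ⟨L, t, ht, hLt⟩ := ((hf x ⟨hsub hx.1, hx.2⟩).mono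
      (Set.inter_subset_inter_left H hball)).exists_lipschitzOnWith ((convex_ball x r).inter hH)
    refine ⟨L, t, ?_, hLt⟩
    rw [Set.inter_comm, ← nhdsWithin_restrict' H (Metric.ball_mem_nhds x hr)] at ht
    exact nhdsWithin_mono x Set.inter_subset_right ht
  obtain ⟨L, hL⟩ := hloc.exists_lipschitzOnWith_of_compact hcomp
  obtain ⟨f', hf', heq⟩ := hL.extend_real
  exact ⟨δ, hδ, L, f', hf', heq⟩

/-! ### Persistence of the homoclinic orbit -/

theorem continuous_amplitude (g : ℝ) : Continuous fun c => amplitude c g :=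
  continuous_const.mul (continuous_disc g).sqrt

theorem continuous_phi1 (g : ℝ) : Continuous fun c => phi1 c g :=
  (continuous_id.sub continuous_const).sub (continuous_disc g).sqrt

/-- With `x` on `profile` and `z` the deviation from it, this bounds the distance from a point of
the perturbed orbit at speed `c` to the unperturbed loop at speed `c₀`. -/
theorem dist_rescale_le {c c₀ g : ℝ} {x z : ℝ × ℝ} (hx : ‖x + z‖ ≤ 3) :
    dist (rescale c g (x + z)) (rescale c₀ g x) ≤ |phi1 c g - phi1 c₀ g|
      + 3 * |amplitude c g - amplitude c₀ g|
      + 3 * |amplitude c g * waveRate c g - amplitude c₀ g * waveRate c₀ g|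
      + (|amplitude c₀ g| + |amplitude c₀ g * waveRate c₀ g|) * ‖z‖ := by
  have comp : ∀ a a₀ b d : ℝ, |b + d| ≤ 3 → |d| ≤ ‖z‖ →
      |a * (b + d) - a₀ * b| ≤ 3 * |a - a₀| + |a₀| * ‖z‖ := fun a a₀ b d h1 h2 => by
    rw [show a * (b + d) - a₀ * b = (b + d) * (a - a₀) + a₀ * d by ring]
    refine (abs_add_le _ _).trans ?_
    rw [abs_mul, abs_mul]
    exact add_le_add (mul_le_mul_of_nonneg_right h1 (abs_nonneg _))
      (mul_le_mul_of_nonneg_left h2 (abs_nonneg _))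
  have h1 := comp (amplitude c g) (amplitude c₀ g) x.1 z.1 ((norm_fst_le (x + z)).trans hx)
    (norm_fst_le z)
  have h2 := comp (amplitude c g * waveRate c g) (amplitude c₀ g * waveRate c₀ g) x.2 z.2
    ((norm_snd_le (x + z)).trans hx) (norm_snd_le z)
  have n1 := mul_nonneg (abs_nonneg (amplitude c₀ g)) (norm_nonneg z)
  have n2 := mul_nonneg (abs_nonneg (amplitude c₀ g * waveRate c₀ g)) (norm_nonneg z)
  have n3 := abs_nonneg (amplitude c g - amplitude c₀ g)
  have n4 := abs_nonneg (amplitude c g * waveRate c g - amplitude c₀ g * waveRate c₀ g)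
  have n5 := abs_nonneg (phi1 c g - phi1 c₀ g)
  rw [Prod.dist_eq, Real.dist_eq, Real.dist_eq]
  refine max_le ?_ ?_
  · have h3 : (rescale c g (x + z)).1 - (rescale c₀ g x).1 = (phi1 c g - phi1 c₀ g)
        + (amplitude c g * (x.1 + z.1) - amplitude c₀ g * x.1) := by
      simp only [rescale, Prod.fst_add]; ring
    rw [h3]
    refine (abs_add_le _ _).trans ?_
    linarith
  · simp only [rescale, Prod.snd_add]
    linarith

/-- The branch of homoclinic solutions of the normal form, for the rescaled reduced system with a
Lipschitz remainder. -/
theorem exists_rescaled_branch {c₀ g : ℝ} (hc : 0 < c₀) (hD : 0 < disc c₀ g)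
    (h0 : melnikovStar c₀ g = 0) {R : C(ℝ × ℝ × ℝ × ℝ, ℝ)} {L : ℝ≥0} (hR : LipschitzWith L R) :
    ∃ K, ∀ᶠ τ in 𝓝[>] (0 : ℝ), ∃ q : ℝ × (ℝ →ᵇ ℝ × ℝ), |q.1 - c₀| ≤ K * τ ∧ ‖q.2‖ ≤ K * τ ∧
      (∀ ξ, HasDerivAt (fun ξ => profile ξ + q.2 ξ)
        (normalField (τ • damping g q.1 + τ ^ 2 • rescaledRemainder g R q.1 τ : C(ℝ × ℝ, ℝ))
          (profile ξ + q.2 ξ)) ξ) ∧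
      ∃ l, Tendsto q.2 (cocompact ℝ) (𝓝 l) ∧
        normalField (τ • damping g q.1 + τ ^ 2 • rescaledRemainder g R q.1 τ : C(ℝ × ℝ, ℝ)) l
          = 0 := by
  obtain ⟨δ, hδ, hsub⟩ := Metric.nhds_basis_closedBall.mem_iff.1
    ((lt_mem_nhds hc).and ((continuous_disc g).continuousAt.eventually (lt_mem_nhds hD)))
  rw [Real.closedBall_eq_Icc] at hsub
  set I := Set.Icc (c₀ - δ) (c₀ + δ) with hI
  have hwave : ContinuousOn (fun c => waveRate c g) I := fun c hc =>
    (continuousAt_waveRate g (hsub hc).1).continuousWithinAt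
  have hamp := (continuous_amplitude g).continuousOn (s := I)
  have hden : ContinuousOn (fun c => c ^ 2 * waveRate c g) I :=
    (continuous_pow 2).continuousOn.mul hwave
  have hden0 : ∀ c ∈ I, c ^ 2 * waveRate c g ≠ 0 := fun c hc =>
    (mul_pos (pow_pos (hsub hc).1 2) (waveRate_pos (hsub hc).1 (hsub hc).2)).ne'
  have hphi := (continuous_phi1 g).continuousOn (s := I)
  have hconst : ContinuousOn (fun c => dampConst c g) I :=
    ContinuousOn.div (by fun_prop) hden hden0
  have hlin : ContinuousOn (fun c => dampLin c g) I := ContinuousOn.div (by fun_prop) hden hden0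
  have hrem : ContinuousOn (fun c => 4 * c / (3 * disc c g)) I :=
    ContinuousOn.div (by fun_prop) (continuous_const.mul (continuous_disc g)).continuousOn
      fun c hc => (mul_pos three_pos (hsub hc).2).ne'
  have hspeed : ContinuousOn (fun c => amplitude c g * waveRate c g) I := hamp.mul hwave
  obtain ⟨M, hM⟩ := isCompact_Icc.exists_bound_of_continuousOn
    (hconst.prodMk (hlin.prodMk (hrem.prodMk (hamp.prodMk hspeed))))
  have hM1 : ∀ c ∈ I, |dampConst c g| ≤ M := fun c hc => (norm_fst_le _).trans (hM c hc)
  have hM' : ∀ c ∈ I, ‖(dampLin c g, 4 * c / (3 * disc c g), amplitude c g,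
    amplitude c g * waveRate c g)‖ ≤ M := fun c hc => (norm_snd_le _).trans (hM c hc)
  have hM2 : ∀ c ∈ I, |dampLin c g| ≤ M := fun c hc => (norm_fst_le _).trans (hM' c hc)
  have hM'' : ∀ c ∈ I, ‖(4 * c / (3 * disc c g), amplitude c g,
    amplitude c g * waveRate c g)‖ ≤ M := fun c hc => (norm_snd_le _).trans (hM' c hc)
  have hM3 : ∀ c ∈ I, |4 * c / (3 * disc c g)| ≤ M := fun c hc =>
    (norm_fst_le _).trans (hM'' c hc)
  have hM''' : ∀ c ∈ I, ‖(amplitude c g, amplitude c g * waveRate c g)‖ ≤ M := fun c hc =>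
    (norm_snd_le _).trans (hM'' c hc)
  have hM4 : ∀ c ∈ I, |amplitude c g| ≤ M := fun c hc => (norm_fst_le _).trans (hM''' c hc)
  have hM5 : ∀ c ∈ I, |amplitude c g * waveRate c g| ≤ M := fun c hc =>
    (norm_snd_le _).trans (hM''' c hc)
  have hrescale : ContinuousOn (fun q : ℝ × (ℝ × ℝ) => rescale q.1 g q.2)
      (I ×ˢ Metric.closedBall 0 3) := by
    have hfst : Set.MapsTo Prod.fst (I ×ˢ Metric.closedBall (0 : ℝ × ℝ) 3) I := fun q hq => hq.1
    refine ((hphi.comp continuousOn_fst hfst).add ((hamp.comp continuousOn_fst hfst).mul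
      (by fun_prop))).prodMk ((hspeed.comp continuousOn_fst hfst).mul (by fun_prop))
  obtain ⟨N, hN⟩ := ((isCompact_Icc (a := c₀ - δ) (b := c₀ + δ)).prod (isCompact_closedBall
    (0 : ℝ × ℝ) 3)).prod (isCompact_Icc (a := (0 : ℝ)) (b := 1)) |>.exists_bound_of_continuousOn
    (f := fun q : (ℝ × (ℝ × ℝ)) × ℝ =>
      R ((rescale q.1.1 g q.1.2).1, (rescale q.1.1 g q.1.2).2, q.1.1, q.2)) (by
      have h1 := hrescale.comp (t := I ×ˢ Metric.closedBall 0 3) continuousOn_fst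
        (s := (I ×ˢ Metric.closedBall 0 3) ×ˢ Set.Icc (0 : ℝ) 1) fun q hq => hq.1
      exact R.continuous.comp_continuousOn (h1.fst.prodMk (h1.snd.prodMk
        (continuous_fst.fst.continuousOn.prodMk continuousOn_snd))))
  obtain ⟨m', hm', hm⟩ := hasDerivAt_pairing_damping hc hD h0
  set B := max (12 * M) (M * N + M * (L * M)) with hB
  have mono : ∀ {P : ℝ × ℝ → ℝ} {ε : ℝ}, SmallOnBall P ε → ε ≤ B → SmallOnBall P B :=
    fun hP h => ⟨fun x hx => (hP.1 x hx).trans h, fun x hx y hy => (hP.2 x hx y hy).trans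
      (mul_le_mul_of_nonneg_right h (norm_nonneg _))⟩
  obtain ⟨K, hK⟩ := exists_homoclinic_branch (Q := damping g) (S := rescaledRemainder g R)
    (B := B) hδ
    (fun c hc => mono (smallOnBall_damping (hM1 c hc) (hM2 c hc)) (le_max_left _ _))
    (fun c hc τ hτ => mono (smallOnBall_rescaledRemainder hR (hM3 c hc) (hM4 c hc) (hM5 c hc)
      fun x hx => hN ((c, x), τ) ⟨⟨hc, hx⟩, hτ⟩) (le_max_right _ _))
    (by
      have hfst : Set.MapsTo Prod.fst (I ×ˢ Metric.closedBall (0 : ℝ × ℝ) 3) I := fun q hq => hq.1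
      exact ((hconst.comp continuousOn_fst hfst).add ((hlin.comp continuousOn_fst hfst).mul
        (continuous_snd.fst.continuousOn))).neg.mul continuous_snd.snd.continuousOn)
    (fun τ _ => by
      have hfst : Set.MapsTo Prod.fst (I ×ˢ Metric.closedBall (0 : ℝ × ℝ) 3) I := fun q hq => hq.1
      exact (hrem.comp continuousOn_fst hfst).mul (R.continuous.comp_continuousOn
        (hrescale.fst.prodMk (hrescale.snd.prodMk
          (continuousOn_fst.prodMk continuousOn_const)))))
    hm hm' (by rw [pairing_damping, h0, mul_zero])
  refine ⟨K, hK.mono fun τ h => ?_⟩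
  obtain ⟨c, z, h⟩ := h
  exact ⟨(c, z), h⟩

/-- At a zero of `M*` the unperturbed loop continues to homoclinic orbits of the reduced system
along a branch `c = c₀ + O(τ)`. -/
theorem exists_homoclinic_near_loop {c₀ g : ℝ} (hc : 0 < c₀) (hD : 0 < disc c₀ g)
    (h0 : melnikovStar c₀ g = 0) (R : ℝ × ℝ × ℝ × ℝ → ℝ) (W : Set (ℝ × ℝ × ℝ × ℝ))
    (hW : IsOpen W) (hΓW : ∀ p ∈ closure (homoclinicLoop c₀ g), (p.1, p.2, c₀, 0) ∈ W)
    (hRW : ContDiffOn ℝ 1 R (W ∩ {q | 0 ≤ q.2.2.2})) :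
    ∃ c : ℝ → ℝ, (fun τ => c τ - c₀) =O[𝓝[>] 0] (fun τ => τ) ∧
      ∀ ε > 0, ∀ᶠ τ in 𝓝[>] 0, ∃ γ : ℝ → ℝ × ℝ,
        IsHomoclinic (reducedField g R (c τ) τ) γ ∧ Near ε (Set.range γ) (homoclinicLoop c₀ g) := by
  have hloop := homoclinicLoop_eq_range_rescale hc hD
  have hcr : Continuous (rescale c₀ g) := by unfold rescale; fun_prop
  have hbdd : Bornology.IsBounded (homoclinicLoop c₀ g) := by
    refine ((isCompact_closedBall (0 : ℝ × ℝ) 2).image hcr).isBounded.subset ?_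
    rw [hloop]
    rintro _ ⟨η, rfl⟩
    exact ⟨profile η, mem_closedBall_zero_iff.2 (norm_profile_apply_le η), rfl⟩
  have hcomp : IsCompact ((fun p : ℝ × ℝ => (p.1, p.2, c₀, (0 : ℝ))) ''
      closure (homoclinicLoop c₀ g)) :=
    (Metric.isCompact_of_isClosed_isBounded isClosed_closure hbdd.closure).image (by fun_prop)
  set Γ := (fun p : ℝ × ℝ => (p.1, p.2, c₀, (0 : ℝ))) '' closure (homoclinicLoop c₀ g) with hΓ
  have hH : IsClosed {q : ℝ × ℝ × ℝ × ℝ | 0 ≤ q.2.2.2} :=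
    isClosed_le continuous_const (by fun_prop)
  have hHconv : Convex ℝ {q : ℝ × ℝ × ℝ × ℝ | 0 ≤ q.2.2.2} := by
    intro x hx y hy a b ha hb _
    exact add_nonneg (mul_nonneg ha hx) (mul_nonneg hb hy)
  obtain ⟨δ, hδ, L, R', hR', heq⟩ := exists_lipschitzWith_eqOn hW hHconv hH hcomp
    (by rintro _ ⟨p, hp, rfl⟩; exact hΓW p hp) hRW
  obtain ⟨K, hK⟩ := exists_rescaled_branch hc hD h0 (R := ⟨R', hR'.continuous⟩) hR'
  obtain ⟨q, hq⟩ := hK.choice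
  have hτ0 : Tendsto (fun τ : ℝ => τ) (𝓝[>] 0) (𝓝 0) := tendsto_id.mono_left nhdsWithin_le_nhds
  have hO : (fun τ => (q τ).1 - c₀) =O[𝓝[>] 0] (fun τ => τ) := by
    refine IsBigO.of_bound K ?_
    filter_upwards [hq, self_mem_nhdsWithin] with τ h (hτ : 0 < τ)
    rw [Real.norm_eq_abs, Real.norm_eq_abs, abs_of_pos hτ]
    exact h.1
  have hqc : Tendsto (fun τ => (q τ).1) (𝓝[>] 0) (𝓝 c₀) := by
    have := hO.trans_tendsto hτ0
    simpa using this.add_const c₀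
  have hqz : Tendsto (fun τ => ‖(q τ).2‖) (𝓝[>] 0) (𝓝 0) := by
    refine squeeze_zero' (Eventually.of_forall fun τ => norm_nonneg _) (hq.mono fun τ h => h.2.1) ?_
    simpa using hτ0.const_mul K
  -- the displacement from the unperturbed loop tends to zero uniformly in time
  have hdisp : Tendsto (fun τ => |phi1 (q τ).1 g - phi1 c₀ g|
      + 3 * |amplitude (q τ).1 g - amplitude c₀ g|
      + 3 * |amplitude (q τ).1 g * waveRate (q τ).1 g - amplitude c₀ g * waveRate c₀ g|
      + (|amplitude c₀ g| + |amplitude c₀ g * waveRate c₀ g|) * ‖(q τ).2‖) (𝓝[>] 0) (𝓝 0) := by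
    have h1 := (((continuous_phi1 g).tendsto c₀).comp hqc).sub_const (phi1 c₀ g) |>.abs
    have hA := ((continuous_amplitude g).tendsto c₀).comp hqc
    have h2 := (hA.sub_const (amplitude c₀ g)).abs.const_mul 3
    have h3 := ((hA.mul ((continuousAt_waveRate g hc).tendsto.comp hqc)).sub_const
      (amplitude c₀ g * waveRate c₀ g)).abs.const_mul 3
    have h4 := hqz.const_mul (|amplitude c₀ g| + |amplitude c₀ g * waveRate c₀ g|)
    have h5 := ((h1.add h2).add h3).add h4
    simp only [sub_self, abs_zero, mul_zero, add_zero] at h5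
    exact h5
  refine ⟨fun τ => (q τ).1, hO, fun ε hε => ?_⟩
  filter_upwards [hq, self_mem_nhdsWithin, hqz.eventually (gt_mem_nhds (half_pos one_pos)),
    hdisp.eventually (gt_mem_nhds hδ), hdisp.eventually (gt_mem_nhds hε),
    hqc.eventually (lt_mem_nhds hc),
    hqc.eventually ((continuous_disc g).continuousAt.eventually (lt_mem_nhds hD)),
    hqc.eventually (Metric.ball_mem_nhds c₀ hδ), hτ0.eventually (gt_mem_nhds hδ)]
    with τ hτ (hτ0 : 0 < τ) hz hdδ hdε hcτ hDτ hcδ hτδ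
  obtain ⟨-, -, hode, l, hl, hl0⟩ := hτ
  have hdist : ∀ η, dist (rescale (q τ).1 g (profile η + (q τ).2 η)) (rescale c₀ g (profile η))
      ≤ _ := fun η => (dist_rescale_le (mem_closedBall_zero_iff.1
        (profile_add_mem (by linarith) η))).trans (add_le_add_right (mul_le_mul_of_nonneg_left
          ((q τ).2.norm_coe_le_norm η) (by positivity)) _)
  have hk := (waveRate_pos hcτ hDτ).ne'
  refine ⟨_, isHomoclinic_rescale hcτ hDτ hode hl hl0 hz
    (Metric.isClosed_cthickening.inter hH) heq fun η => ⟨?_, hτ0.le⟩, ?_, ?_⟩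
  · refine Metric.mem_cthickening_of_dist_le _ ((rescale c₀ g (profile η)).1,
      (rescale c₀ g (profile η)).2, c₀, 0) _ _
      ⟨_, subset_closure (hloop ▸ ⟨η, rfl⟩), rfl⟩ ?_
    have h1 := (hdist η).trans hdδ.le
    rw [Prod.dist_eq] at h1
    simp only [Prod.dist_eq]
    refine max_le ((le_max_left _ _).trans h1) (max_le ((le_max_right _ _).trans h1)
      (max_le (le_of_lt hcδ) ?_))
    rw [Real.dist_eq, sub_zero, abs_of_pos hτ0]
    exact hτδ.le
  · rintro _ ⟨ξ, rfl⟩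
    exact Metric.mem_thickening_iff.2 ⟨_, hloop ▸ ⟨_, rfl⟩, (hdist _).trans_lt hdε⟩
  · rw [hloop]
    rintro _ ⟨η, rfl⟩
    refine Metric.mem_thickening_iff.2 ⟨_, ⟨η / waveRate (q τ).1 g, rfl⟩, ?_⟩
    rw [dist_comm]
    simp only [mul_div_cancel₀ _ hk]
    exact (hdist η).trans_lt hdε

end RLW

end

theorem mainTheorem4 (g : ℝ) :
    (∀ c : ℝ, 0 < c → -2 * g < (c - 1) ^ 2 →
      RLW.melnikov c g = -(24 / (5 * c ^ 2)) * √(1 / c)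
        * (c ^ 2 - 2 * c + 2 * g + 1) ^ (5 / 4 : ℝ) * RLW.melnikovStar c g) ∧
    (-1 / 2 < g →
      ∃ c₀ : ℝ, 0 < c₀ ∧ -2 * g < (c₀ - 1) ^ 2 ∧
        RLW.melnikov c₀ g = 0 ∧ deriv (fun c => RLW.melnikov c g) c₀ ≠ 0 ∧
        (∀ c : ℝ, 0 < c → -2 * g < (c - 1) ^ 2 → RLW.melnikov c g = 0 → c = c₀) ∧
        ∀ (R : ℝ × ℝ × ℝ × ℝ → ℝ) (W : Set (ℝ × ℝ × ℝ × ℝ)), IsOpen W →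
          (∀ p ∈ closure (RLW.homoclinicLoop c₀ g), (p.1, p.2, c₀, 0) ∈ W) →
          ContDiffOn ℝ 1 R (W ∩ {q | 0 ≤ q.2.2.2}) →
          ∃ c : ℝ → ℝ,
            (fun τ => c τ - c₀) =O[𝓝[>] 0] (fun τ => τ) ∧
            ∀ ε > 0, ∀ᶠ τ in 𝓝[>] 0, ∃ γ : ℝ → ℝ × ℝ,
              RLW.IsHomoclinic (RLW.reducedField g R (c τ) τ) γ ∧
              RLW.Near ε (Set.range γ) (RLW.homoclinicLoop c₀ g)) := by
  refine ⟨fun c hc hg => RLW.melnikov_eq hc hg, fun hg => ?_⟩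
  obtain ⟨c₀, hc, hD, h0, huniq⟩ := RLW.exists_melnikovStar_eq_zero hg
  refine ⟨c₀, hc, by rw [RLW.disc] at hD; linarith, (RLW.melnikov_eq_zero_iff hc hD).2 h0,
    RLW.deriv_melnikov_ne_zero hc hD h0, fun c hc' hg' h => ?_,
    RLW.exists_homoclinic_near_loop hc hD h0⟩
  have hD' : 0 < RLW.disc c g := by rw [RLW.disc]; linarith
  exact huniq c hc' hD' ((RLW.melnikov_eq_zero_iff hc' hD').1 h)
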